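/- For all positive constants $C_3,C_4,C_5$ there exist positive constants $C_1,C_2$, depending only on $C_3,C_4,C_5$, such that the following holds. Let $n,p\ge 1$ and $K\ge 2$ be integers, let $G_1^*,\dots,G_K^*$ be a partition of $\{1,\dots,n\}$ into nonempty clusters of sizes $n_1,\dots,n_K$, let $V^{(1)},\dots,V^{(K)}$ be positive definite real $p\times p$ matrices, and let $t\ge 0$ and $\beta\in(0,1)$. Put $\bar n=\max_k n_k$, $\underline n=\min_k n_k$, $m=\min_{k\ne l}\frac{2n_kn_l}{n_k+n_l}$, $\mathcal V=\max_k\|V^{(k)}\|_{\mathrm{op}}$, $T_v=\max_k \mathrm{Tr}[(V^{(k)})^{-1}]$ and $$\Delta^2=\min_{k\ne l} d^2(V^{(k)},V^{(l)}),\qquad d^2(U,V)=\mathrm{Tr}\big[U+V-2(U^{1/2}VU^{1/2})^{1/2}\big].$$ Let $X_1,\dots,X_n$ be i.i.d. random symmetric $p\times p$ matrices whose entries on and above the diagonal are independent standard normal variables, and for $i\in G_k^*$ let $$\nu_i=N(0,V_i),\qquad V_i=(I+tX_i)\,V^{(k)}\,(I+tX_i).$$ Suppose that $$\Delta^2>\frac{C_1t^2}{\min\{(1-\beta)^2,\beta^2\}}\,\mathcal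 V\,p^2\log n,\qquad \underline n\ge C_3\log^2 n,$$ $$t\le \frac{C_4\sqrt{\log n}}{(p+\log\bar n)\,\mathcal V^{1/2}T_v^{1/2}},\qquad \frac nm\le C_5\log n .$$ Then, with probability at least $1-C_2/n$, the semidefinite program $$\min_{Z\in\mathbb R^{n\times n}}\Big\{\langle A,Z\rangle: Z^\top=Z,\ Z\succeq 0,\ \mathrm{Tr}(Z)=K,\ Z\mathbf 1_n=\mathbf 1_n,\ Z\ge 0\text{ entrywise}\Big\},\qquad A_{ij}=W_2^2(\nu_i,\nu_j),$$ where $W_2$ is the 2-Wasserstein distance, has the true membership matrix $Z^*=\sum_{k=1}^K\frac1{n_k}\mathbf 1_{G_k^*}\mathbf 1_{G_k^*}^\top$ as its unique solution. -/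

import Mathlib

open MeasureTheory ProbabilityTheory Matrix
open scoped MatrixOrder

noncomputable section

namespace WassersteinSDP

/-! ### Wasserstein and Bures distances -/

/-- Squared 2-Wasserstein distance: the infimum of `∫ ‖x - y‖² dπ` over all couplings `π`. -/
def wassersteinSq {E : Type*} [NormedAddCommGroup E] [MeasurableSpace E]
    (μ ν : Measure E) : ℝ :=
  (⨅ π ∈ {π : Measure (E × E) | π.map Prod.fst = μ ∧ π.map Prod.snd = ν},
    ∫⁻ z, ‖z.1 - z.2‖ₑ ^ 2 ∂π).toReal

/-- Centered Gaussian measure `N(0, V)` on `ℝᵖ` with the Euclidean norm. -/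
def centeredGaussian {p : ℕ} (V : Matrix (Fin p) (Fin p) ℝ) :
    Measure (EuclideanSpace ℝ (Fin p)) :=
  multivariateGaussian 0 V

/-- Squared Bures distance `Tr[U + V - 2 (U^{1/2} V U^{1/2})^{1/2}]`. -/
def buresSq {p : ℕ} (U V : Matrix (Fin p) (Fin p) ℝ) : ℝ :=
  (U + V - (2 : ℝ) • CFC.sqrt (CFC.sqrt U * V * CFC.sqrt U)).trace

/-! ### The semidefinite program -/

/-- Feasible set: `Zᵀ = Z`, `Z ⪰ 0`, `Tr Z = K`, `Z 1 = 1`, `Z ≥ 0` entrywise. -/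
def sdpFeasible (n K : ℕ) : Set (Matrix (Fin n) (Fin n) ℝ) :=
  {Z | Zᵀ = Z ∧ Z.PosSemidef ∧ Z.trace = K ∧ (Z *ᵥ fun _ => 1) = (fun _ => 1) ∧
    ∀ i j, 0 ≤ Z i j}

/-- Objective `⟨A, Z⟩ = ∑ᵢⱼ Aᵢⱼ Zᵢⱼ`. -/
def sdpObjective {n : ℕ} (A Z : Matrix (Fin n) (Fin n) ℝ) : ℝ :=
  ∑ i, ∑ j, A i j * Z i j

/-- `Z₀` is the unique minimizer of `⟨A, Z⟩` over the feasible set. -/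
def IsUniqueSDPSolution {n : ℕ} (K : ℕ) (A Z₀ : Matrix (Fin n) (Fin n) ℝ) : Prop :=
  Z₀ ∈ sdpFeasible n K ∧
    ∀ Z ∈ sdpFeasible n K, Z ≠ Z₀ → sdpObjective A Z₀ < sdpObjective A Z

/-! ### Clusters: `g i` is the label of item `i`, and the `k`-th cluster is `g ⁻¹' {k}` -/

/-- The size `n_k` of the `k`-th cluster. -/
def clusterSize {n K : ℕ} (g : Fin n → Fin K) (k : Fin K) : ℕ :=
  (Finset.univ.filter fun i => g i = k).card

/-- Largest cluster size. -/
def maxClusterSize {n K : ℕ} (g : Fin n → Fin K) : ℕ := ⨆ k, clusterSize g k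

/-- Smallest cluster size. -/
def minClusterSize {n K : ℕ} (g : Fin n → Fin K) : ℕ := ⨅ k, clusterSize g k

/-- Minimal pairwise harmonic mean `m = min_{k ≠ l} 2 n_k n_l / (n_k + n_l)`. -/
def minHarmonicMean {n K : ℕ} (g : Fin n → Fin K) : ℝ :=
  ⨅ q : {q : Fin K × Fin K // q.1 ≠ q.2},
    2 * (clusterSize g q.1.1 : ℝ) * clusterSize g q.1.2 /
      (clusterSize g q.1.1 + clusterSize g q.1.2)

/-- True membership matrix `∑ₖ n_k⁻¹ 1_{G_k} 1_{G_k}ᵀ`. -/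
def membershipMatrix {n K : ℕ} (g : Fin n → Fin K) : Matrix (Fin n) (Fin n) ℝ :=
  ∑ k, (clusterSize g k : ℝ)⁻¹ •
    vecMulVec (fun i => if g i = k then (1 : ℝ) else 0) (fun i => if g i = k then (1 : ℝ) else 0)

/-! ### Parameters of the cluster centers -/

/-- Minimal squared separation `Δ² = min_{k ≠ l} d²(V^(k), V^(l))`. -/
def separationSq {p K : ℕ} (V : Fin K → Matrix (Fin p) (Fin p) ℝ) : ℝ :=
  ⨅ q : {q : Fin K × Fin K // q.1 ≠ q.2}, buresSq (V q.1.1) (V q.1.2)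

/-- `𝒱 = max_k ‖V^(k)‖_op`, with the Euclidean operator norm. -/
def maxOpNorm {p K : ℕ} (V : Fin K → Matrix (Fin p) (Fin p) ℝ) : ℝ :=
  ⨆ k, ‖toEuclideanCLM (𝕜 := ℝ) (V k)‖

/-- `T_v = max_k Tr[(V^(k))⁻¹]`. -/
def maxTraceInv {p K : ℕ} (V : Fin K → Matrix (Fin p) (Fin p) ℝ) : ℝ :=
  ⨆ k, ((V k)⁻¹).trace

/-! ### The random model -/

/-- `X₁, …, Xₙ` are i.i.d. `SymN(0,1)`: symmetric random matrices whose entries on and above the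
diagonal are independent standard normal variables, independent also across the matrices. -/
structure IsIIDSymN {Ω : Type*} [MeasurableSpace Ω] (P : Measure Ω) {n p : ℕ}
    (X : Fin n → Ω → Matrix (Fin p) (Fin p) ℝ) : Prop where
  symm : ∀ i, ∀ᵐ ω ∂P, (X i ω).IsSymm
  law : ∀ i a b, a ≤ b → HasLaw (fun ω => X i ω a b) (gaussianReal 0 1) P
  indep : iIndepFun
    (fun (q : Fin n × {ab : Fin p × Fin p // ab.1 ≤ ab.2}) ω => X q.1 ω q.2.1.1 q.2.1.2) P

/-- `Vᵢ = (I + t Xᵢ) V^(k) (I + t Xᵢ)` for `i` in the `k`-th cluster. -/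
def perturbedCov {n p K : ℕ} (g : Fin n → Fin K) (V : Fin K → Matrix (Fin p) (Fin p) ℝ) (t : ℝ)
    (X : Fin n → Matrix (Fin p) (Fin p) ℝ) (i : Fin n) : Matrix (Fin p) (Fin p) ℝ :=
  (1 + t • X i) * V (g i) * (1 + t • X i)

/-- Matrix of squared Wasserstein distances between the observed Gaussians `N(0, Vᵢ)`. -/
def distanceMatrix {n p : ℕ} (V : Fin n → Matrix (Fin p) (Fin p) ℝ) :
    Matrix (Fin n) (Fin n) ℝ :=
  Matrix.of fun i j => wassersteinSq (centeredGaussian (V i)) (centeredGaussian (V j))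

end WassersteinSDP

end

/-!
The proof is a deterministic analysis of the semidefinite program combined with crude bounds on
Frobenius norms of the noise; write `xᵢ = ‖Xᵢ‖_F²` and `𝒱 = maxOpNorm V`.

*Distances.* Inside a cluster, `N(0, Vᵢ)` and `N(0, Vⱼ)` are linear images of one Gaussian, which
couples them at cost at most `2 t² 𝒱 (xᵢ + xⱼ)` (`distanceMatrix_le`). Across clusters, a coupling
of `N(0, Vᵢ)` and `N(0, Vⱼ)` is glued with the laws of `(ξ, (1 + t Xᵢ) ξ)` to a coupling of the
unperturbed Gaussians, whose cost is at least the squared Bures distance by Kantorovich duality with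
quadratic potentials (`buresSq_le_lintegral`). Hence
`Δ² ≤ 2 Aᵢⱼ + 4 t² 𝒱 (xᵢ + xⱼ)` (`separationSq_le_distanceMatrix`).

*Semidefinite program.* Let `P` be the membership matrix and, for a feasible `Z`, let `rᵢ` be the
mass of row `i` outside its cluster. Inside the `k`-th cluster, with `δₖ = ∑_{i ∈ Gₖ} rᵢ`,
`Zᵢⱼ - Pᵢⱼ = -(rᵢ + rⱼ) / nₖ + δₖ / nₖ² + Wᵢⱼ`, where `W = (1 - P) Z (1 - P)` is positive
semidefinite with trace `∑ rᵢ / n_{g i}`. Since `|Wᵢⱼ| ≤ √Wᵢᵢ √Wⱼⱼ`, replacing `P` by `Z` lowers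
the cost inside the clusters by at most `∑ rᵢ` times a multiple of
`t² 𝒱 (max xᵢ + ‖x‖₂ √n / min nₖ)`, and raises the cost across clusters by at least `∑ rᵢ` times the
smallest distance there (`sdpObjective_gap`). If `∑ rᵢ = 0`, then `Z = P` (`eq_membershipMatrix`).

*Noise.* With probability `1 - O(1 / n)` one has `max xᵢ ≲ p² log n`, by an exponential moment, and
`∑ xᵢ² ≲ p⁴ n`, by Chebyshev's inequality (`IsIIDSymN.measureReal_frobSq_le`). Because
`n / min nₖ ≤ 2 n / m ≲ log n`, both error terms are of the order `t² 𝒱 p² log n`, which the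
separation hypothesis beats once `C₁` is large.
-/

namespace WassersteinSDP

/-! ### The semidefinite program -/

section SDP

variable {n K : ℕ} (g : Fin n → Fin K)

lemma clusterSize_pos (i : Fin n) : (0 : ℝ) < clusterSize g (g i) := by
  have : 0 < clusterSize g (g i) := Finset.card_pos.2 ⟨i, by simp⟩
  exact_mod_cast this

lemma membershipMatrix_apply (i j : Fin n) :
    membershipMatrix g i j = if g i = g j then (clusterSize g (g i) : ℝ)⁻¹ else 0 := by
  rw [membershipMatrix, Matrix.sum_apply,
    Finset.sum_eq_single (g i) (by intro k _ hk; simp [vecMulVec_apply, hk.symm]) (by simp)]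
  simp [vecMulVec_apply, eq_comm]

lemma sum_cluster_const (i : Fin n) (c : ℝ) :
    (∑ j, if g i = g j then c else 0) = clusterSize g (g i) * c := by
  rw [← Finset.sum_filter, Finset.sum_const, nsmul_eq_mul]
  simp [clusterSize, eq_comm]

lemma sum_inv_clusterSize (hg : Function.Surjective g) :
    ∑ i, (clusterSize g (g i) : ℝ)⁻¹ = K := by
  rw [← Finset.sum_fiberwise Finset.univ g]
  have h : ∀ k, ∑ i with g i = k, (clusterSize g (g i) : ℝ)⁻¹ = 1 := by
    intro k
    obtain ⟨i, rfl⟩ := hg k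
    rw [Finset.sum_congr rfl (g := fun _ => (clusterSize g (g i) : ℝ)⁻¹)
      (by intro j hj; rw [(Finset.mem_filter.1 hj).2]), Finset.sum_const, nsmul_eq_mul]
    exact mul_inv_cancel₀ (clusterSize_pos g i).ne'
  simp [h]

lemma membershipMatrix_isSymm : (membershipMatrix g)ᵀ = membershipMatrix g := by
  ext i j
  simp only [transpose_apply, membershipMatrix_apply]
  by_cases h : g i = g j
  · simp [h]
  · simp [h, Ne.symm h]

lemma membershipMatrix_mem_sdpFeasible (hg : Function.Surjective g) :
    membershipMatrix g ∈ sdpFeasible n K := by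
  refine ⟨membershipMatrix_isSymm g, ?_, ?_, ?_, ?_⟩
  · refine Matrix.posSemidef_sum _ fun k _ => Matrix.PosSemidef.smul ?_ (by positivity)
    simpa using Matrix.posSemidef_vecMulVec_self_star
      (R := ℝ) (fun i => if g i = k then (1 : ℝ) else 0)
  · simp [Matrix.trace, membershipMatrix_apply, sum_inv_clusterSize g hg]
  · ext i
    simp only [mulVec, dotProduct, membershipMatrix_apply, mul_one, sum_cluster_const]
    exact mul_inv_cancel₀ (clusterSize_pos g i).ne'
  · intro i j
    rw [membershipMatrix_apply]
    split_ifs <;> positivity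

/-- The mass that the `i`-th row of `Z` puts outside the cluster of `i`. -/
noncomputable def crossMass (Z : Matrix (Fin n) (Fin n) ℝ) (i : Fin n) : ℝ :=
  ∑ j, if g i = g j then 0 else Z i j

/-- The compression `(1 - P) Z (1 - P)` of `Z` to the orthogonal complement of the cluster
indicators, where `P` is the membership matrix. -/
noncomputable def residual (Z : Matrix (Fin n) (Fin n) ℝ) : Matrix (Fin n) (Fin n) ℝ :=
  (1 - membershipMatrix g) * Z * (1 - membershipMatrix g)

variable {g} {Z : Matrix (Fin n) (Fin n) ℝ}

lemma crossMass_nonneg (hZ : Z ∈ sdpFeasible n K) (i : Fin n) : 0 ≤ crossMass g Z i :=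
  Finset.sum_nonneg fun j _ => by
    split_ifs
    exacts [le_rfl, hZ.2.2.2.2 i j]

lemma sum_cluster_eq (hZ : Z ∈ sdpFeasible n K) (i : Fin n) :
    (∑ j, if g i = g j then Z i j else 0) = 1 - crossMass g Z i := by
  have h : ∑ j, Z i j = 1 := by
    simpa [mulVec, dotProduct] using congrFun hZ.2.2.2.1 i
  rw [← h, crossMass, ← Finset.sum_sub_distrib]
  refine Finset.sum_congr rfl fun j _ => ?_
  split_ifs <;> ring

lemma mul_membershipMatrix_apply (hZ : Z ∈ sdpFeasible n K) {i j : Fin n} (hij : g i = g j) :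
    (Z * membershipMatrix g) i j = (1 - crossMass g Z i) / clusterSize g (g i) := by
  rw [mul_apply, ← sum_cluster_eq hZ, Finset.sum_div]
  refine Finset.sum_congr rfl fun l _ => ?_
  rw [membershipMatrix_apply, ← hij]
  by_cases h : g i = g l
  · simp [h, div_eq_mul_inv]
  · simp [h, Ne.symm h]

lemma membershipMatrix_mul_apply (hZ : Z ∈ sdpFeasible n K) {i j : Fin n} (hij : g i = g j) :
    (membershipMatrix g * Z) i j = (1 - crossMass g Z j) / clusterSize g (g i) := by
  have h : membershipMatrix g * Z = (Z * membershipMatrix g)ᵀ := by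
    rw [transpose_mul, membershipMatrix_isSymm, hZ.1]
  rw [h, transpose_apply, mul_membershipMatrix_apply hZ hij.symm, hij]

/-- Inside a cluster, `Z` differs from the membership matrix by the residual and by terms that are
linear in the mass leaving the cluster. -/
lemma residual_apply (hZ : Z ∈ sdpFeasible n K) {i j : Fin n} (hij : g i = g j) :
    residual g Z i j = Z i j - (clusterSize g (g i) : ℝ)⁻¹
      + (crossMass g Z i + crossMass g Z j) / clusterSize g (g i)
      - (∑ l, if g i = g l then crossMass g Z l else 0) / clusterSize g (g i) ^ 2 := by
  have hN := (clusterSize_pos g i).ne'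
  have e : residual g Z = Z - membershipMatrix g * Z - Z * membershipMatrix g
      + membershipMatrix g * (Z * membershipMatrix g) := by
    rw [residual]; noncomm_ring
  have h3 : (membershipMatrix g * (Z * membershipMatrix g)) i j =
      (∑ l, if g i = g l then 1 - crossMass g Z l else 0) / clusterSize g (g i) ^ 2 := by
    rw [mul_apply, Finset.sum_div]
    refine Finset.sum_congr rfl fun l _ => ?_
    rw [membershipMatrix_apply]
    by_cases h : g i = g l
    · rw [if_pos h, if_pos h, mul_membershipMatrix_apply hZ (h.symm.trans hij), ← h]
      field_simp
    · simp [h]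
  have h4 : (∑ l, if g i = g l then 1 - crossMass g Z l else 0) =
      clusterSize g (g i) - ∑ l, if g i = g l then crossMass g Z l else 0 := by
    rw [← mul_one (clusterSize g (g i) : ℝ), ← sum_cluster_const, ← Finset.sum_sub_distrib]
    refine Finset.sum_congr rfl fun l _ => ?_
    split_ifs <;> ring
  rw [e, Matrix.add_apply, Matrix.sub_apply, Matrix.sub_apply, h3, h4,
    mul_membershipMatrix_apply hZ hij, membershipMatrix_mul_apply hZ hij]
  field_simp
  ring

lemma residual_posSemidef (hZ : Z ∈ sdpFeasible n K) : (residual g Z).PosSemidef := by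
  have h := hZ.2.1.conjTranspose_mul_mul_same (1 - membershipMatrix g)
  rwa [conjTranspose_eq_transpose_of_trivial, transpose_sub, transpose_one,
    membershipMatrix_isSymm] at h

/-- Double counting over pairs in a common cluster. -/
lemma sum_sum_cluster_div (f : Fin n → ℝ) :
    (∑ i, ∑ j, if g i = g j then f j / clusterSize g (g i) else 0) = ∑ j, f j := by
  rw [Finset.sum_comm]
  refine Finset.sum_congr rfl fun j _ => ?_
  have : ∀ i, (if g i = g j then f j / clusterSize g (g i) else 0) =
      if g j = g i then f j / clusterSize g (g j) else 0 := by
    intro i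
    by_cases h : g i = g j
    · simp [h]
    · simp [h, Ne.symm h]
  rw [Finset.sum_congr rfl fun i _ => this i, sum_cluster_const]
  exact mul_div_cancel₀ _ (clusterSize_pos g j).ne'

lemma sum_residual_diag (hg : Function.Surjective g) (hZ : Z ∈ sdpFeasible n K) :
    ∑ i, residual g Z i i = ∑ i, crossMass g Z i / clusterSize g (g i) := by
  have h : ∀ i, residual g Z i i = Z i i - (clusterSize g (g i) : ℝ)⁻¹
      + 2 * (crossMass g Z i / clusterSize g (g i))
      - ∑ l, if g i = g l then (crossMass g Z l / clusterSize g (g l)) / clusterSize g (g i)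
          else 0 := by
    intro i
    rw [residual_apply hZ rfl, Finset.sum_div]
    congr 1
    · ring
    · refine Finset.sum_congr rfl fun l _ => ?_
      by_cases h : g i = g l
      · rw [if_pos h, if_pos h, ← h, sq, div_div]
      · simp [h]
  have hK : ∑ i, Z i i = K := hZ.2.2.1
  rw [Finset.sum_congr rfl fun i _ => h i, Finset.sum_sub_distrib, Finset.sum_add_distrib,
    Finset.sum_sub_distrib, sum_inv_clusterSize g hg, hK,
    sum_sum_cluster_div (fun l => crossMass g Z l / clusterSize g (g l)), ← Finset.mul_sum]
  ring

/-- The entries of a positive semidefinite matrix are dominated by its diagonal. -/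
lemma abs_apply_le_of_posSemidef {W : Matrix (Fin n) (Fin n) ℝ} (hW : W.PosSemidef)
    (i j : Fin n) : |W i j| ≤ √(W i i) * √(W j j) := by
  have hd : ∀ k, 0 ≤ W k k := fun k => hW.diag_nonneg
  have hs : W j i = W i j := by simpa using congrFun (congrFun hW.1 i) j
  have hq : ∀ a : ℝ, 0 ≤ W i i * (a * a) + 2 * W i j * a + W j j := by
    intro a
    have h := hW.dotProduct_mulVec_nonneg (Pi.single i a + Pi.single j 1)
    simp [mulVec_add, dotProduct_add, add_dotProduct, hs] at h
    linarith
  have hdisc := discrim_le_zero hq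
  rw [discrim] at hdisc
  rw [← Real.sqrt_mul (hd i), ← Real.sqrt_sq_eq_abs]
  exact Real.sqrt_le_sqrt (by linarith)

lemma residual_eq_zero (hg : Function.Surjective g) (hZ : Z ∈ sdpFeasible n K)
    (h0 : ∀ i, crossMass g Z i = 0) (i j : Fin n) : residual g Z i j = 0 := by
  have hW := residual_posSemidef (g := g) hZ
  have h := sum_residual_diag hg hZ
  simp only [h0, zero_div, Finset.sum_const_zero] at h
  have hi := (Finset.sum_eq_zero_iff_of_nonneg fun k _ => hW.diag_nonneg).1 h i (Finset.mem_univ _)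
  have := abs_apply_le_of_posSemidef hW i j
  rw [hi, Real.sqrt_zero, zero_mul] at this
  exact abs_nonpos_iff.1 this

/-- A feasible matrix without mass between different clusters is the membership matrix. -/
lemma eq_membershipMatrix (hg : Function.Surjective g) (hZ : Z ∈ sdpFeasible n K)
    (h : ∑ i, crossMass g Z i = 0) : Z = membershipMatrix g := by
  have h0 : ∀ i, crossMass g Z i = 0 := fun i =>
    (Finset.sum_eq_zero_iff_of_nonneg fun k _ => crossMass_nonneg hZ k).1 h i (Finset.mem_univ _)
  ext i j
  rw [membershipMatrix_apply]
  by_cases hij : g i = g j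
  · have h1 := residual_apply hZ hij
    rw [residual_eq_zero hg hZ h0 i j] at h1
    simp only [h0, ite_self, Finset.sum_const_zero, zero_div, add_zero, sub_zero] at h1
    rw [if_pos hij]
    linarith
  · have hnn : ∀ l ∈ Finset.univ, 0 ≤ (if g i = g l then 0 else Z i l) := fun l _ => by
      split_ifs
      exacts [le_rfl, hZ.2.2.2.2 i l]
    simpa [hij] using (Finset.sum_eq_zero_iff_of_nonneg hnn).1 (h0 i) j (Finset.mem_univ _)

lemma sum_sum_mul_sqrt_le (x w : Fin n → ℝ) (hw : ∀ i, 0 ≤ w i) {s : ℝ}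
    (hs0 : 0 ≤ s) (hs : ∑ i, x i ^ 2 ≤ s ^ 2) :
    ∑ i, ∑ j, (x i + x j) * (√(w i) * √(w j)) ≤ 2 * s * √n * ∑ i, w i := by
  have e : ∑ i, ∑ j, (x i + x j) * (√(w i) * √(w j)) =
      2 * ((∑ i, x i * √(w i)) * ∑ j, √(w j)) := by
    have h1 : ∀ i, ∑ j, (x i + x j) * (√(w i) * √(w j)) =
        x i * √(w i) * (∑ j, √(w j)) + √(w i) * ∑ j, x j * √(w j) := by
      intro i
      rw [Finset.mul_sum, Finset.mul_sum, ← Finset.sum_add_distrib]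
      exact Finset.sum_congr rfl fun j _ => by ring
    rw [Finset.sum_congr rfl fun i _ => h1 i, Finset.sum_add_distrib, ← Finset.sum_mul,
      ← Finset.sum_mul]
    ring
  have hw2 : ∑ i, √(w i) ^ 2 = ∑ i, w i :=
    Finset.sum_congr rfl fun i _ => Real.sq_sqrt (hw i)
  have hW : 0 ≤ ∑ i, w i := Finset.sum_nonneg fun i _ => hw i
  have c1 : ∑ i, x i * √(w i) ≤ s * √(∑ i, w i) := by
    refine (Real.sum_mul_le_sqrt_mul_sqrt _ _ _).trans ?_
    rw [hw2]
    gcongr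
    exact (Real.sqrt_le_left hs0).2 hs
  have c2 : ∑ j, √(w j) ≤ √n * √(∑ i, w i) := by
    have := Real.sum_mul_le_sqrt_mul_sqrt Finset.univ (fun _ : Fin n => (1 : ℝ)) (fun i => √(w i))
    simpa [hw2] using this
  have h0 : 0 ≤ ∑ j, √(w j) := Finset.sum_nonneg fun i _ => Real.sqrt_nonneg _
  calc _ = 2 * ((∑ i, x i * √(w i)) * ∑ j, √(w j)) := e
    _ ≤ 2 * ((s * √(∑ i, w i)) * (√n * √(∑ i, w i))) := by gcongr
    _ = 2 * s * √n * (√(∑ i, w i) * √(∑ i, w i)) := by ring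
    _ = _ := by rw [Real.mul_self_sqrt hW]

/-- Deterministic gap of the objective. If costs are at least `D` across clusters and lie between
`0` and `c (x i + x j)` inside clusters, then moving mass `∑ i, crossMass g Z i` across clusters
raises the objective at a definite rate: only the maximum `ξ` and the `ℓ²` norm of `x` matter,
the latter being divided by the smallest cluster size. -/
theorem sdpObjective_gap (hg : Function.Surjective g) (hZ : Z ∈ sdpFeasible n K)
    {A : Matrix (Fin n) (Fin n) ℝ} {D c ξ s L : ℝ} {x : Fin n → ℝ}
    (hc : 0 ≤ c) (hs0 : 0 ≤ s) (hL : 0 < L) (hx : ∀ i, 0 ≤ x i) (hxξ : ∀ i, x i ≤ ξ)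
    (hs : ∑ i, x i ^ 2 ≤ s ^ 2) (hLN : ∀ k, L ≤ clusterSize g k)
    (hA0 : ∀ i j, g i = g j → 0 ≤ A i j) (hA1 : ∀ i j, g i = g j → A i j ≤ c * (x i + x j))
    (hA2 : ∀ i j, g i ≠ g j → D ≤ A i j) :
    (D - 4 * c * ξ - 2 * c * s * √n / L) * ∑ i, crossMass g Z i ≤
      sdpObjective A Z - sdpObjective A (membershipMatrix g) := by
  set r := crossMass g Z with hr
  set W := residual g Z with hWdef
  have hr0 : ∀ i, 0 ≤ r i := crossMass_nonneg hZ
  have hW : W.PosSemidef := residual_posSemidef hZ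
  have hwd : ∀ i, 0 ≤ W i i := fun i => hW.diag_nonneg
  have hpt : ∀ i j, D * (if g i = g j then 0 else Z i j)
      - 2 * c * ξ * ((if g i = g j then r i / clusterSize g (g i) else 0)
        + (if g i = g j then r j / clusterSize g (g i) else 0))
      - c * ((x i + x j) * (√(W i i) * √(W j j)))
      ≤ A i j * Z i j - A i j * membershipMatrix g i j := by
    intro i j
    rw [membershipMatrix_apply]
    have hQ : 0 ≤ c * ((x i + x j) * (√(W i i) * √(W j j))) := by
      have := hx i; have := hx j; positivity
    by_cases hij : g i = g j
    · simp only [if_pos hij]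
      have hN := clusterSize_pos g i
      set N : ℝ := (clusterSize g (g i) : ℝ) with hNdef
      have hres := residual_apply hZ hij
      set T := (∑ l, if g i = g l then crossMass g Z l else 0) / (clusterSize g (g i) : ℝ) ^ 2
      have hT : 0 ≤ T := by
        refine div_nonneg (Finset.sum_nonneg fun l _ => ?_) (by positivity)
        split_ifs
        exacts [hr0 l, le_rfl]
      have e : A i j * Z i j - A i j * N⁻¹ =
          A i j * W i j - A i j * ((r i + r j) / N) + A i j * T := by
        rw [hWdef, hres]; ring
      have a0 := hA0 i j hij
      have a1 := hA1 i j hij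
      have b1 : A i j * ((r i + r j) / N) ≤ 2 * c * ξ * ((r i + r j) / N) := by
        refine mul_le_mul_of_nonneg_right ?_ (div_nonneg (add_nonneg (hr0 i) (hr0 j)) hN.le)
        nlinarith [hxξ i, hxξ j]
      have b2 : -(c * ((x i + x j) * (√(W i i) * √(W j j)))) ≤ A i j * W i j := by
        have h1 := abs_apply_le_of_posSemidef hW i j
        have h2 : |A i j * W i j| ≤ c * (x i + x j) * (√(W i i) * √(W j j)) := by
          rw [abs_mul, abs_of_nonneg a0]
          exact mul_le_mul a1 h1 (abs_nonneg _) (a0.trans a1)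
        have := neg_abs_le (A i j * W i j)
        linarith
      have b3 : 0 ≤ A i j * T := mul_nonneg a0 hT
      rw [e, ← add_div]
      linarith
    · simp only [if_neg hij]
      have := mul_le_mul_of_nonneg_right (hA2 i j hij) (hZ.2.2.2.2 i j)
      linarith
  have hsum := Finset.sum_le_sum fun i (_ : i ∈ Finset.univ) =>
    Finset.sum_le_sum fun j (_ : j ∈ Finset.univ) => hpt i j
  simp only [Finset.sum_sub_distrib, Finset.sum_add_distrib, ← Finset.mul_sum] at hsum
  have s1 : (∑ i, ∑ j, if g i = g j then r i / (clusterSize g (g i) : ℝ) else 0) = ∑ i, r i := by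
    refine Finset.sum_congr rfl fun i _ => ?_
    rw [sum_cluster_const]
    exact mul_div_cancel₀ _ (clusterSize_pos g i).ne'
  have s2 : (∑ i, ∑ j, if g i = g j then 0 else Z i j) = ∑ i, r i := rfl
  have s3 : ∑ i, W i i ≤ (∑ i, r i) / L := by
    rw [hWdef, sum_residual_diag hg hZ, Finset.sum_div]
    exact Finset.sum_le_sum fun i _ => div_le_div_of_nonneg_left (hr0 i) hL (hLN _)
  rw [s1, s2, sum_sum_cluster_div] at hsum
  have s4 := sum_sum_mul_sqrt_le x (fun i => W i i) hwd hs0 hs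
  have s5 : c * ∑ i, ∑ j, (x i + x j) * (√(W i i) * √(W j j)) ≤
      2 * c * s * √n / L * ∑ i, r i := by
    calc _ ≤ c * (2 * s * √n * ∑ i, W i i) := by gcongr
      _ ≤ c * (2 * s * √n * ((∑ i, r i) / L)) := by gcongr
      _ = _ := by ring
  unfold sdpObjective
  linarith

/-- Recovery criterion for the semidefinite program. -/
theorem isUniqueSDPSolution_of_gap (hg : Function.Surjective g)
    {A : Matrix (Fin n) (Fin n) ℝ} {D c ξ s L : ℝ} {x : Fin n → ℝ}
    (hc : 0 ≤ c) (hs0 : 0 ≤ s) (hL : 0 < L) (hx : ∀ i, 0 ≤ x i) (hxξ : ∀ i, x i ≤ ξ)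
    (hs : ∑ i, x i ^ 2 ≤ s ^ 2) (hLN : ∀ k, L ≤ clusterSize g k)
    (hA0 : ∀ i j, g i = g j → 0 ≤ A i j) (hA1 : ∀ i j, g i = g j → A i j ≤ c * (x i + x j))
    (hA2 : ∀ i j, g i ≠ g j → D ≤ A i j)
    (hD : 4 * c * ξ + 2 * c * s * √n / L < D) :
    IsUniqueSDPSolution K A (membershipMatrix g) := by
  refine ⟨membershipMatrix_mem_sdpFeasible g hg, fun Z hZ hne => ?_⟩
  have hgap := sdpObjective_gap hg hZ hc hs0 hL hx hxξ hs hLN hA0 hA1 hA2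
  have hpos : 0 < ∑ i, crossMass g Z i :=
    lt_of_le_of_ne (Finset.sum_nonneg fun i _ => crossMass_nonneg hZ i)
      fun h => hne (eq_membershipMatrix hg hZ h.symm)
  have := mul_pos (sub_pos.2 hD) hpos
  linarith

lemma minHarmonicMean_le (hK : 2 ≤ K) (hg : Function.Surjective g) (k : Fin K) :
    minHarmonicMean g ≤ 2 * clusterSize g k := by
  have : Nontrivial (Fin K) := Fin.nontrivial_iff_two_le.2 hK
  obtain ⟨l, hl⟩ := exists_ne k
  obtain ⟨i, rfl⟩ := hg k
  obtain ⟨j, rfl⟩ := hg l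
  refine (ciInf_le (Set.finite_range _).bddBelow ⟨(g i, g j), hl.symm⟩).trans ?_
  have h1 := clusterSize_pos g i
  have h2 := clusterSize_pos g j
  rw [div_le_iff₀ (by positivity)]
  nlinarith [mul_pos h1 h1]

lemma minHarmonicMean_pos (hK : 2 ≤ K) (hg : Function.Surjective g) :
    0 < minHarmonicMean g := by
  have : Nontrivial (Fin K) := Fin.nontrivial_iff_two_le.2 hK
  obtain ⟨k, l, hkl⟩ := exists_pair_ne (Fin K)
  have : Nonempty {q : Fin K × Fin K // q.1 ≠ q.2} := ⟨⟨(k, l), hkl⟩⟩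
  obtain ⟨⟨⟨a, b⟩, _⟩, hq⟩ := exists_eq_ciInf_of_finite
    (f := fun q : {q : Fin K × Fin K // q.1 ≠ q.2} =>
      2 * (clusterSize g q.1.1 : ℝ) * clusterSize g q.1.2 /
        (clusterSize g q.1.1 + clusterSize g q.1.2))
  rw [minHarmonicMean, ← hq]
  obtain ⟨i, rfl⟩ := hg a
  obtain ⟨j, rfl⟩ := hg b
  have h1 := clusterSize_pos g i
  have h2 := clusterSize_pos g j
  positivity

end SDP

/-! ### Second moments of centered Gaussians -/

section Gaussian

variable {p : ℕ}

lemma map_centeredGaussian {V : Matrix (Fin p) (Fin p) ℝ} (hV : V.PosSemidef)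
    (B : Matrix (Fin p) (Fin p) ℝ) :
    (centeredGaussian V).map (toEuclideanCLM (𝕜 := ℝ) B) = centeredGaussian (B * V * Bᵀ) := by
  have hB : (B * V * Bᵀ).PosSemidef := by
    simpa using hV.mul_mul_conjTranspose_same B
  unfold centeredGaussian
  apply Measure.ext_of_charFun
  ext t
  rw [charFun_multivariateGaussian hB, charFun_apply,
    integral_map (by fun_prop) (by fun_prop)]
  have h := charFun_multivariateGaussian (μ := 0) hV (WithLp.toLp 2 (Bᵀ *ᵥ t))
  rw [charFun_apply] at h
  have e : ∀ x : EuclideanSpace ℝ (Fin p), inner ℝ (toEuclideanCLM (𝕜 := ℝ) B x) t =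
      inner ℝ x (WithLp.toLp 2 (Bᵀ *ᵥ t)) := by
    intro x
    simp only [EuclideanSpace.inner_eq_star_dotProduct, star_trivial, ofLp_toEuclideanCLM]
    rw [dotProduct_mulVec, mulVec_transpose]
  simp only [e, h, inner_zero_right]
  congr 4
  rw [← mulVec_mulVec, ← mulVec_mulVec, dotProduct_mulVec t.ofLp B, mulVec_transpose]

lemma memLp_centeredGaussian (V : Matrix (Fin p) (Fin p) ℝ) (i : Fin p) :
    MemLp (fun x : EuclideanSpace ℝ (Fin p) => x i) 2 (centeredGaussian V) := by
  unfold centeredGaussian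
  exact IsGaussian.memLp_dual (multivariateGaussian 0 V) (EuclideanSpace.proj i) 2 (by simp)

instance (V : Matrix (Fin p) (Fin p) ℝ) : IsProbabilityMeasure (centeredGaussian V) := by
  unfold centeredGaussian; infer_instance

lemma integral_mul_centeredGaussian {V : Matrix (Fin p) (Fin p) ℝ} (hV : V.PosSemidef)
    (i j : Fin p) : ∫ x, x i * x j ∂centeredGaussian V = V i j := by
  have h := covariance_eval_multivariateGaussian (μ := 0) hV i j
  have hm : ∀ k : Fin p, ∫ x, x k ∂multivariateGaussian 0 V = 0 := by
    intro k
    have := (EuclideanSpace.proj (𝕜 := ℝ) k).integral_comp_id_comm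
      (μ := multivariateGaussian 0 V) IsGaussian.integrable_id
    simpa using this
  rw [covariance, hm, hm] at h
  simpa [centeredGaussian] using h

lemma integrable_quadratic (V M : Matrix (Fin p) (Fin p) ℝ) :
    Integrable (fun x : EuclideanSpace ℝ (Fin p) => x ⬝ᵥ M *ᵥ x) (centeredGaussian V) := by
  simp only [dotProduct, mulVec, Finset.mul_sum]
  refine integrable_finsetSum _ fun i _ => integrable_finsetSum _ fun j _ => ?_
  have := ((memLp_centeredGaussian V i).integrable_mul (memLp_centeredGaussian V j)).const_mul
    (M i j)
  refine this.congr (ae_of_all _ fun x => ?_)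
  simp only [Pi.mul_apply]
  ring

/-- The expectation of a quadratic form under `N(0, V)`. -/
lemma integral_quadratic {V : Matrix (Fin p) (Fin p) ℝ} (hV : V.PosSemidef)
    (M : Matrix (Fin p) (Fin p) ℝ) :
    ∫ x, x ⬝ᵥ M *ᵥ x ∂centeredGaussian V = (M * V).trace := by
  have hi : ∀ i j, Integrable (fun x : EuclideanSpace ℝ (Fin p) => M i j * (x i * x j))
      (centeredGaussian V) := fun i j =>
    ((memLp_centeredGaussian V i).integrable_mul (memLp_centeredGaussian V j)).const_mul (M i j)
  have e : ∀ x : EuclideanSpace ℝ (Fin p), x ⬝ᵥ M *ᵥ x = ∑ i, ∑ j, M i j * (x i * x j) := by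
    intro x
    simp only [dotProduct, mulVec, Finset.mul_sum]
    exact Finset.sum_congr rfl fun i _ => Finset.sum_congr rfl fun j _ => by ring
  simp only [e]
  rw [integral_finsetSum _ fun i _ => integrable_finsetSum _ fun j _ => hi i j]
  simp only [trace, diag, mul_apply]
  refine Finset.sum_congr rfl fun i _ => ?_
  rw [integral_finsetSum _ fun j _ => hi i j]
  refine Finset.sum_congr rfl fun j _ => ?_
  rw [integral_const_mul, integral_mul_centeredGaussian hV]
  congr 1
  simpa using congrFun (congrFun hV.1 j) i

lemma lintegral_norm_sq_centeredGaussian {V : Matrix (Fin p) (Fin p) ℝ} (hV : V.PosSemidef)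
    (M : Matrix (Fin p) (Fin p) ℝ) :
    ∫⁻ x, ‖toEuclideanCLM (𝕜 := ℝ) M x‖ₑ ^ 2 ∂centeredGaussian V =
      ENNReal.ofReal (M * V * Mᵀ).trace := by
  have e : ∀ x : EuclideanSpace ℝ (Fin p), ‖toEuclideanCLM (𝕜 := ℝ) M x‖ ^ 2 =
      x ⬝ᵥ (Mᵀ * M) *ᵥ x := by
    intro x
    rw [← real_inner_self_eq_norm_sq, EuclideanSpace.inner_eq_star_dotProduct]
    simp only [star_trivial, ofLp_toEuclideanCLM]
    rw [← mulVec_mulVec, dotProduct_mulVec, dotProduct_comm, mulVec_transpose]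
  have e2 : ∀ x : EuclideanSpace ℝ (Fin p), ‖toEuclideanCLM (𝕜 := ℝ) M x‖ₑ ^ 2 =
      ENNReal.ofReal (x ⬝ᵥ (Mᵀ * M) *ᵥ x) := by
    intro x
    rw [← e, ENNReal.ofReal_pow (norm_nonneg _), ofReal_norm]
  simp only [e2]
  rw [← ofReal_integral_eq_lintegral_ofReal (integrable_quadratic V _)
    (ae_of_all _ fun x => by simp only [Pi.zero_apply, ← e]; positivity),
    integral_quadratic hV, trace_mul_comm (M * V), ← mul_assoc]

end Gaussian

/-! ### Couplings and gluing -/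

section Wasserstein

variable {E : Type*} [NormedAddCommGroup E] [MeasurableSpace E] {μ ν : Measure E}

lemma wassersteinSq_nonneg : 0 ≤ wassersteinSq μ ν := ENNReal.toReal_nonneg

lemma wassersteinSq_le {π : Measure (E × E)} (h1 : π.map Prod.fst = μ) (h2 : π.map Prod.snd = ν)
    {c : ℝ} (hc : 0 ≤ c) (h : ∫⁻ z, ‖z.1 - z.2‖ₑ ^ 2 ∂π ≤ ENNReal.ofReal c) :
    wassersteinSq μ ν ≤ c :=
  ENNReal.toReal_le_of_le_ofReal hc ((iInf₂_le π ⟨h1, h2⟩).trans h)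

lemma le_wassersteinSq {c : ℝ} (hc : ∀ π : Measure (E × E), π.map Prod.fst = μ →
      π.map Prod.snd = ν → ENNReal.ofReal c ≤ ∫⁻ z, ‖z.1 - z.2‖ₑ ^ 2 ∂π)
    {π : Measure (E × E)} (h1 : π.map Prod.fst = μ) (h2 : π.map Prod.snd = ν)
    (h : ∫⁻ z, ‖z.1 - z.2‖ₑ ^ 2 ∂π ≠ ⊤) : c ≤ wassersteinSq μ ν := by
  have hle : ENNReal.ofReal c ≤
      ⨅ π ∈ {π : Measure (E × E) | π.map Prod.fst = μ ∧ π.map Prod.snd = ν},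
        ∫⁻ z, ‖z.1 - z.2‖ₑ ^ 2 ∂π := le_iInf₂ fun π hπ => hc π hπ.1 hπ.2
  refine (ENNReal.ofReal_le_iff_le_toReal ?_).1 hle
  exact ne_top_of_le_ne_top h (iInf₂_le π ⟨h1, h2⟩)

lemma enorm_sub_sq_le {E : Type*} [NormedAddCommGroup E] (ξ x y η : E) :
    ‖ξ - η‖ₑ ^ 2 ≤ 2 * ‖x - y‖ₑ ^ 2 + 4 * ‖x - ξ‖ₑ ^ 2 + 4 * ‖y - η‖ₑ ^ 2 := by
  have h : ‖ξ - η‖ ≤ ‖x - y‖ + ‖x - ξ‖ + ‖y - η‖ := by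
    have e : ξ - η = (x - y) - (x - ξ) + (y - η) := by abel
    rw [e]
    exact (norm_add_le _ _).trans (add_le_add_left (norm_sub_le _ _) _)
  have h2 : ‖ξ - η‖ ^ 2 ≤ 2 * ‖x - y‖ ^ 2 + 4 * ‖x - ξ‖ ^ 2 + 4 * ‖y - η‖ ^ 2 := by
    have := pow_le_pow_left₀ (norm_nonneg _) h 2
    nlinarith [sq_nonneg (‖x - y‖ - (‖x - ξ‖ + ‖y - η‖)), sq_nonneg (‖x - ξ‖ - ‖y - η‖)]
  have h3 := ENNReal.ofReal_le_ofReal h2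
  rw [ENNReal.ofReal_add (by positivity) (by positivity),
    ENNReal.ofReal_add (by positivity) (by positivity), ENNReal.ofReal_mul (by norm_num),
    ENNReal.ofReal_mul (by norm_num), ENNReal.ofReal_mul (by norm_num)] at h3
  simpa only [ENNReal.ofReal_pow (norm_nonneg _), ofReal_norm, ENNReal.ofReal_ofNat] using h3

lemma lintegral_prod_enorm_sub_sq_ne_top [BorelSpace E] [SecondCountableTopology E]
    [IsProbabilityMeasure μ] [IsProbabilityMeasure ν]
    (hμ : ∫⁻ x, ‖x‖ₑ ^ 2 ∂μ ≠ ⊤) (hν : ∫⁻ x, ‖x‖ₑ ^ 2 ∂ν ≠ ⊤) :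
    ∫⁻ z, ‖z.1 - z.2‖ₑ ^ 2 ∂μ.prod ν ≠ ⊤ := by
  refine ne_top_of_le_ne_top (b := 4 * ∫⁻ x, ‖x‖ₑ ^ 2 ∂μ + 4 * ∫⁻ x, ‖x‖ₑ ^ 2 ∂ν)
    (ENNReal.add_ne_top.2 ⟨ENNReal.mul_ne_top (by simp) hμ, ENNReal.mul_ne_top (by simp) hν⟩) ?_
  have h1 : ∫⁻ z, ‖z.1‖ₑ ^ 2 ∂μ.prod ν = ∫⁻ x, ‖x‖ₑ ^ 2 ∂μ := by
    conv_rhs => rw [← Measure.fst_prod (μ := μ) (ν := ν), Measure.fst]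
    rw [lintegral_map (by fun_prop) measurable_fst]
  have h2 : ∫⁻ z, ‖z.2‖ₑ ^ 2 ∂μ.prod ν = ∫⁻ x, ‖x‖ₑ ^ 2 ∂ν := by
    conv_rhs => rw [← Measure.snd_prod (μ := μ) (ν := ν), Measure.snd]
    rw [lintegral_map (by fun_prop) measurable_snd]
  rw [← h1, ← h2, ← lintegral_const_mul _ (by fun_prop), ← lintegral_const_mul _ (by fun_prop),
    ← lintegral_add_right _ (by fun_prop)]
  refine lintegral_mono fun z => ?_
  simpa using enorm_sub_sq_le z.1 0 0 z.2

end Wasserstein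

/-- Gluing: a random variable `x` with the law of `f` under `ν` can be realised, on an extension
of its probability space, as the image under `f` of a variable with law `ν`. -/
lemma exists_measure_prod_lift {Ω E F : Type*} [MeasurableSpace Ω] [MeasurableSpace E]
    [MeasurableSpace F] [StandardBorelSpace F] [Nonempty F]
    (ρ : Measure Ω) [IsFiniteMeasure ρ] (ν : Measure F) [IsFiniteMeasure ν]
    {x : Ω → E} (hx : Measurable x) {f : F → E} (hf : Measurable f) (h : ρ.map x = ν.map f) :
    ∃ ρ' : Measure (Ω × F), IsFiniteMeasure ρ' ∧ ρ'.map Prod.fst = ρ ∧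
      ρ'.map (fun z => (x z.1, z.2)) = ν.map (fun u => (f u, u)) := by
  set τ : Measure (E × F) := ν.map fun u => (f u, u) with hτ
  have hfu : Measurable fun u => (f u, u) := hf.prodMk measurable_id
  have hfst : τ.fst = ρ.map x := by
    rw [h, Measure.fst, hτ, Measure.map_map measurable_fst hfu]
    rfl
  refine ⟨ρ ⊗ₘ (τ.condKernel.comap x hx), inferInstance, Measure.fst_compProd _ _, ?_⟩
  have hdis := τ.disintegrate τ.condKernel
  rw [hfst] at hdis
  refine Eq.trans ?_ hdis
  ext s hs
  have hm : Measurable fun z : Ω × F => (x z.1, z.2) :=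
    (hx.comp measurable_fst).prodMk measurable_snd
  rw [Measure.map_apply hm hs, Measure.compProd_apply (hm hs), Measure.compProd_apply hs,
    lintegral_map (Kernel.measurable_kernel_prodMk_left hs) hx]
  rfl

/-- Every coupling of the images of `ν₁` under `f` and of `ν₂` under `g` lifts, by gluing twice, to
a coupling of `ν₁` and `ν₂` whose cost exceeds twice the given one by at most the squared
displacements of `f` and `g`. -/
lemma exists_coupling_lintegral_le {E : Type*} [NormedAddCommGroup E] [MeasurableSpace E]
    [BorelSpace E] [SecondCountableTopology E] [StandardBorelSpace E]
    {π : Measure (E × E)} [IsFiniteMeasure π] {ν₁ ν₂ : Measure E} [IsFiniteMeasure ν₁]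
    [IsFiniteMeasure ν₂] {f g : E → E} (hf : Measurable f) (hg : Measurable g)
    (h1 : π.map Prod.fst = ν₁.map f) (h2 : π.map Prod.snd = ν₂.map g) :
    ∃ π' : Measure (E × E), π'.map Prod.fst = ν₁ ∧ π'.map Prod.snd = ν₂ ∧
      ∫⁻ z, ‖z.1 - z.2‖ₑ ^ 2 ∂π' ≤ 2 * ∫⁻ z, ‖z.1 - z.2‖ₑ ^ 2 ∂π
        + 4 * ∫⁻ u, ‖f u - u‖ₑ ^ 2 ∂ν₁ + 4 * ∫⁻ u, ‖g u - u‖ₑ ^ 2 ∂ν₂ := by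
  obtain ⟨ρ, hρ, hρ1, hρ2⟩ := exists_measure_prod_lift π ν₁ measurable_fst hf h1
  obtain ⟨σ, hσ, hσ1, hσ2⟩ := exists_measure_prod_lift ρ ν₂
    (x := fun z : (E × E) × E => z.1.2) (by fun_prop) hg (by
      rw [← h2, ← hρ1, Measure.map_map measurable_snd measurable_fst]
      rfl)
  have mf : Measurable fun u => (f u, u) := hf.prodMk measurable_id
  have mg : Measurable fun u => (g u, u) := hg.prodMk measurable_id
  have hρν : ρ.map Prod.snd = ν₁ := by
    have := congrArg (Measure.map Prod.snd) hρ2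
    rwa [Measure.map_map measurable_snd (by fun_prop), Measure.map_map measurable_snd mf,
      show Prod.snd ∘ (fun u => (f u, u)) = id from rfl, Measure.map_id] at this
  have hσν : σ.map Prod.snd = ν₂ := by
    have := congrArg (Measure.map Prod.snd) hσ2
    rwa [Measure.map_map measurable_snd (by fun_prop), Measure.map_map measurable_snd mg,
      show Prod.snd ∘ (fun u => (g u, u)) = id from rfl, Measure.map_id] at this
  have c1 : ∫⁻ z, ‖z.1.1.1 - z.1.1.2‖ₑ ^ 2 ∂σ = ∫⁻ z, ‖z.1 - z.2‖ₑ ^ 2 ∂π := by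
    rw [← hρ1, lintegral_map (by fun_prop) measurable_fst, ← hσ1,
      lintegral_map (by fun_prop) measurable_fst]
  have c2 : ∫⁻ z, ‖z.1.1.1 - z.1.2‖ₑ ^ 2 ∂σ = ∫⁻ u, ‖f u - u‖ₑ ^ 2 ∂ν₁ := by
    have h3 : ∫⁻ z, ‖z.1.1.1 - z.1.2‖ₑ ^ 2 ∂σ = ∫⁻ z, ‖z.1.1 - z.2‖ₑ ^ 2 ∂ρ := by
      rw [← hσ1, lintegral_map (by fun_prop) measurable_fst]
    have h4 := lintegral_map (μ := ρ) (f := fun z : E × E => ‖z.1 - z.2‖ₑ ^ 2) (by fun_prop)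
      (show Measurable fun z : (E × E) × E => (z.1.1, z.2) by fun_prop)
    rw [hρ2, lintegral_map (by fun_prop) mf] at h4
    rw [h3, ← h4]
  have c3 : ∫⁻ z, ‖z.1.1.2 - z.2‖ₑ ^ 2 ∂σ = ∫⁻ u, ‖g u - u‖ₑ ^ 2 ∂ν₂ := by
    have h4 := lintegral_map (μ := σ) (f := fun z : E × E => ‖z.1 - z.2‖ₑ ^ 2) (by fun_prop)
      (show Measurable fun z : ((E × E) × E) × E => (z.1.1.2, z.2) by fun_prop)
    rw [hσ2, lintegral_map (by fun_prop) mg] at h4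
    rw [← h4]
  refine ⟨σ.map fun z => (z.1.2, z.2), ?_, ?_, ?_⟩
  · rw [Measure.map_map measurable_fst (by fun_prop), ← hρν, ← hσ1,
      Measure.map_map measurable_snd measurable_fst]
    rfl
  · rw [Measure.map_map measurable_snd (by fun_prop), ← hσν]
    rfl
  · rw [lintegral_map (by fun_prop) (by fun_prop)]
    have hpt : ∀ z : ((E × E) × E) × E, ‖z.1.2 - z.2‖ₑ ^ 2 ≤ 2 * ‖z.1.1.1 - z.1.1.2‖ₑ ^ 2
        + 4 * ‖z.1.1.1 - z.1.2‖ₑ ^ 2 + 4 * ‖z.1.1.2 - z.2‖ₑ ^ 2 :=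
      fun z => enorm_sub_sq_le _ _ _ _
    refine (lintegral_mono hpt).trans_eq ?_
    rw [lintegral_add_right _ (by fun_prop), lintegral_add_right _ (by fun_prop),
      lintegral_const_mul _ (by fun_prop), lintegral_const_mul _ (by fun_prop),
      lintegral_const_mul _ (by fun_prop), c1, c2, c3]

/-! ### The Bures distance and linear images -/

section Bures

variable {p : ℕ} {U V S : Matrix (Fin p) (Fin p) ℝ}

/-- Young's inequality for the quadratic form of `S` and its Legendre dual. -/
lemma two_mul_dotProduct_le (hS : S.PosDef) (x y : Fin p → ℝ) :
    2 * (x ⬝ᵥ y) ≤ x ⬝ᵥ S *ᵥ x + y ⬝ᵥ S⁻¹ *ᵥ y := by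
  have hu : IsUnit S.det := S.isUnit_iff_isUnit_det.1 hS.isUnit
  have hT : Sᵀ = S := by simpa using hS.1.eq
  have h := hS.posSemidef.dotProduct_mulVec_nonneg (x - S⁻¹ *ᵥ y)
  have e1 : S *ᵥ (S⁻¹ *ᵥ y) = y := by rw [mulVec_mulVec, mul_nonsing_inv _ hu, one_mulVec]
  have e2 : (S⁻¹ *ᵥ y) ⬝ᵥ (S *ᵥ x) = x ⬝ᵥ y := by
    rw [dotProduct_mulVec, ← mulVec_transpose, hT, e1, dotProduct_comm]
  rw [star_trivial, mulVec_sub, e1, sub_dotProduct, dotProduct_sub, dotProduct_sub, e2,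
    dotProduct_comm (S⁻¹ *ᵥ y) y] at h
  linarith

/-- The optimal transport matrix between `N(0, U)` and `N(0, V)` gives optimal Kantorovich
potentials: both traces equal that of the geometric mean term in the Bures distance. -/
lemma exists_posDef_buresSq_eq (hU : U.PosDef) (hV : V.PosDef) :
    ∃ S : Matrix (Fin p) (Fin p) ℝ, S.PosDef ∧
      buresSq U V = U.trace + V.trace - ((S * U).trace + (S⁻¹ * V).trace) := by
  set R := CFC.sqrt U with hR
  have hRR : R * R = U := CFC.sqrt_mul_sqrt_self U hU.posSemidef.nonneg
  have hR0 : R.PosSemidef := (CFC.sqrt_nonneg U).posSemidef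
  have hRT : Rᴴ = R := hR0.1.eq
  have hRu : IsUnit R := by
    rw [← isUnit_pow_iff (n := 2) two_ne_zero, sq, hRR]
    exact hU.isUnit
  have hRd : IsUnit R.det := R.isUnit_iff_isUnit_det.1 hRu
  have hRp : R.PosDef := hR0.posDef_iff_isUnit.2 hRu
  set N := R * V * R with hN
  have hN0 : N.PosSemidef := by
    have := hV.posSemidef.mul_mul_conjTranspose_same R
    rwa [hRT] at this
  set M := CFC.sqrt N with hM
  have hMM : M * M = N := CFC.sqrt_mul_sqrt_self N hN0.nonneg
  have hM0 : M.PosSemidef := (CFC.sqrt_nonneg N).posSemidef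
  have hMu : IsUnit M := by
    rw [← isUnit_pow_iff (n := 2) two_ne_zero, sq, hMM]
    exact (hRu.mul hV.isUnit).mul hRu
  have hMd : IsUnit M.det := M.isUnit_iff_isUnit_det.1 hMu
  have hS0 : (R⁻¹ * M * R⁻¹).PosSemidef := by
    have := hM0.mul_mul_conjTranspose_same R⁻¹
    rwa [hRp.inv.1.eq] at this
  have hRiu : IsUnit R⁻¹ := hRp.inv.isUnit
  refine ⟨R⁻¹ * M * R⁻¹, hS0.posDef_iff_isUnit.2 ((hRiu.mul hMu).mul hRiu), ?_⟩
  have t1 : (R⁻¹ * M * R⁻¹ * U).trace = M.trace := by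
    rw [← hRR, ← mul_assoc, mul_assoc _ R⁻¹ R, nonsing_inv_mul _ hRd, mul_one, mul_assoc,
      trace_mul_comm, mul_assoc, mul_nonsing_inv _ hRd, mul_one]
  have t2 : ((R⁻¹ * M * R⁻¹)⁻¹ * V).trace = M.trace := by
    have e : M⁻¹ * R * V * R = M := by
      rw [mul_assoc, mul_assoc, ← mul_assoc R, ← hN, ← hMM, ← mul_assoc, nonsing_inv_mul _ hMd,
        one_mul]
    rw [Matrix.mul_inv_rev, Matrix.mul_inv_rev, nonsing_inv_nonsing_inv _ hRd, mul_assoc,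
      trace_mul_comm, e]
  rw [t1, t2, buresSq, trace_sub, trace_add, trace_smul, ← hR, ← hN, ← hM, smul_eq_mul]
  ring

/-- Gelbrich's lower bound: every coupling of `N(0, U)` and `N(0, V)` costs at least the squared
Bures distance. -/
lemma buresSq_le_lintegral (hU : U.PosDef) (hV : V.PosDef)
    {π : Measure (EuclideanSpace ℝ (Fin p) × EuclideanSpace ℝ (Fin p))}
    (hπU : π.map Prod.fst = centeredGaussian U) (hπV : π.map Prod.snd = centeredGaussian V) :
    ENNReal.ofReal (buresSq U V) ≤ ∫⁻ z, ‖z.1 - z.2‖ₑ ^ 2 ∂π := by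
  obtain ⟨S, hS, hb⟩ := exists_posDef_buresSq_eq hU hV
  have hpt : ∀ z : EuclideanSpace ℝ (Fin p) × EuclideanSpace ℝ (Fin p),
      ENNReal.ofReal (z.1 ⬝ᵥ (1 - S) *ᵥ z.1 + z.2 ⬝ᵥ (1 - S⁻¹) *ᵥ z.2) ≤
      ‖z.1 - z.2‖ₑ ^ 2 := by
    intro z
    rw [← ofReal_norm, ← ENNReal.ofReal_pow (norm_nonneg _)]
    refine ENNReal.ofReal_le_ofReal ?_
    have h := two_mul_dotProduct_le hS (z.1) (z.2)
    rw [← real_inner_self_eq_norm_sq, EuclideanSpace.inner_eq_star_dotProduct]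
    simp only [star_trivial, WithLp.ofLp_sub, sub_mulVec, one_mulVec, dotProduct_sub,
      sub_dotProduct, dotProduct_comm (z.2) (z.1)]
    linarith
  have hi1 : Integrable (fun z => z.1 ⬝ᵥ (1 - S) *ᵥ z.1) π := by
    have := integrable_quadratic U (1 - S)
    rw [← hπU] at this
    exact this.comp_measurable measurable_fst
  have hi2 : Integrable (fun z => z.2 ⬝ᵥ (1 - S⁻¹) *ᵥ z.2) π := by
    have := integrable_quadratic V (1 - S⁻¹)
    rw [← hπV] at this
    exact this.comp_measurable measurable_snd
  have h1 : ∫ z, z.1 ⬝ᵥ (1 - S) *ᵥ z.1 ∂π = ((1 - S) * U).trace := by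
    rw [← integral_quadratic hU.posSemidef, ← hπU, integral_map measurable_fst.aemeasurable]
    rw [hπU]
    exact (integrable_quadratic U (1 - S)).aestronglyMeasurable
  have h2 : ∫ z, z.2 ⬝ᵥ (1 - S⁻¹) *ᵥ z.2 ∂π = ((1 - S⁻¹) * V).trace := by
    rw [← integral_quadratic hV.posSemidef, ← hπV, integral_map measurable_snd.aemeasurable]
    rw [hπV]
    exact (integrable_quadratic V (1 - S⁻¹)).aestronglyMeasurable
  calc ENNReal.ofReal (buresSq U V)
      = ENNReal.ofReal (∫ z, (z.1 ⬝ᵥ (1 - S) *ᵥ z.1 + z.2 ⬝ᵥ (1 - S⁻¹) *ᵥ z.2) ∂π) := by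
        rw [integral_add hi1 hi2, h1, h2, hb, sub_mul, sub_mul, trace_sub, trace_sub, one_mul,
          one_mul]
        congr 1
        ring
    _ ≤ ∫⁻ z, ENNReal.ofReal (z.1 ⬝ᵥ (1 - S) *ᵥ z.1 + z.2 ⬝ᵥ (1 - S⁻¹) *ᵥ z.2) ∂π := by
        have := integral_eq_lintegral_pos_part_sub_lintegral_neg_part (hi1.add hi2)
        simp only [Pi.add_apply] at this
        rw [this]
        refine (ENNReal.ofReal_le_ofReal (sub_le_self _ ENNReal.toReal_nonneg)).trans ?_
        exact ENNReal.ofReal_toReal_le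
    _ ≤ _ := lintegral_mono hpt

/-- The squared Frobenius norm of a matrix. -/
def frobSq (B : Matrix (Fin p) (Fin p) ℝ) : ℝ := ∑ a, ∑ b, B a b ^ 2

lemma frobSq_nonneg (B : Matrix (Fin p) (Fin p) ℝ) : 0 ≤ frobSq B :=
  Finset.sum_nonneg fun _ _ => Finset.sum_nonneg fun _ _ => sq_nonneg _

lemma frobSq_sub_le (B C : Matrix (Fin p) (Fin p) ℝ) :
    frobSq (B - C) ≤ 2 * (frobSq B + frobSq C) := by
  simp only [frobSq, mul_add, Finset.mul_sum, ← Finset.sum_add_distrib, Matrix.sub_apply]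
  gcongr with a _ b _
  nlinarith [sq_nonneg (B a b + C a b)]

lemma frobSq_smul (t : ℝ) (B : Matrix (Fin p) (Fin p) ℝ) :
    frobSq (t • B) = t ^ 2 * frobSq B := by
  simp only [frobSq, Finset.mul_sum, Matrix.smul_apply, smul_eq_mul, mul_pow]

lemma trace_mul_mul_transpose_nonneg (hV : V.PosSemidef) (B : Matrix (Fin p) (Fin p) ℝ) :
    0 ≤ (B * V * Bᵀ).trace := by
  simpa using (hV.mul_mul_conjTranspose_same B).trace_nonneg

lemma trace_mul_mul_transpose_le (V B : Matrix (Fin p) (Fin p) ℝ) :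
    (B * V * Bᵀ).trace ≤ ‖toEuclideanCLM (𝕜 := ℝ) V‖ * frobSq B := by
  rw [trace, frobSq, Finset.mul_sum]
  refine Finset.sum_le_sum fun a _ => ?_
  set b : EuclideanSpace ℝ (Fin p) := WithLp.toLp 2 (B a) with hb
  have e : (B * V * Bᵀ).diag a = inner ℝ b (toEuclideanCLM (𝕜 := ℝ) V b) := by
    rw [EuclideanSpace.inner_eq_star_dotProduct, star_trivial, ofLp_toEuclideanCLM, diag,
      mul_assoc, mul_apply, dotProduct_comm]
    simp [hb, dotProduct, mulVec, mul_apply]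
  have e2 : ∑ c, B a c ^ 2 = ‖b‖ * ‖b‖ := by
    rw [← sq, EuclideanSpace.norm_sq_eq]
    simp [hb]
  rw [e, e2]
  refine (real_inner_le_norm _ _).trans ?_
  have := (toEuclideanCLM (𝕜 := ℝ) V).le_opNorm b
  nlinarith [norm_nonneg b]

/-- Linear images of one centered Gaussian, coupled through that Gaussian. -/
lemma wassersteinSq_map_le (hV : V.PosSemidef) (B C : Matrix (Fin p) (Fin p) ℝ) :
    wassersteinSq (centeredGaussian (B * V * Bᵀ)) (centeredGaussian (C * V * Cᵀ)) ≤
      ((B - C) * V * (B - C)ᵀ).trace := by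
  have hm : Measurable fun x => (toEuclideanCLM (𝕜 := ℝ) B x, toEuclideanCLM (𝕜 := ℝ) C x) := by
    fun_prop
  refine wassersteinSq_le (π := (centeredGaussian V).map
    fun x => (toEuclideanCLM (𝕜 := ℝ) B x, toEuclideanCLM (𝕜 := ℝ) C x)) ?_ ?_
    (trace_mul_mul_transpose_nonneg hV _) ?_
  · rw [Measure.map_map measurable_fst hm, ← map_centeredGaussian hV]
    rfl
  · rw [Measure.map_map measurable_snd hm, ← map_centeredGaussian hV]
    rfl
  · rw [lintegral_map (by fun_prop) hm, ← lintegral_norm_sq_centeredGaussian hV, map_sub]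
    rfl

/-- Every coupling of linear images of `N(0, U)` and `N(0, V)` lifts, by gluing, to a coupling of
`N(0, U)` and `N(0, V)` themselves, whose cost is at least the squared Bures distance. -/
lemma ofReal_buresSq_le_of_coupling (hU : U.PosDef) (hV : V.PosDef)
    (B C : Matrix (Fin p) (Fin p) ℝ)
    {π : Measure (EuclideanSpace ℝ (Fin p) × EuclideanSpace ℝ (Fin p))}
    (h1 : π.map Prod.fst = centeredGaussian (B * U * Bᵀ))
    (h2 : π.map Prod.snd = centeredGaussian (C * V * Cᵀ)) :
    ENNReal.ofReal (buresSq U V) ≤ 2 * ∫⁻ z, ‖z.1 - z.2‖ₑ ^ 2 ∂π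
      + 4 * ENNReal.ofReal ((B - 1) * U * (B - 1)ᵀ).trace
      + 4 * ENNReal.ofReal ((C - 1) * V * (C - 1)ᵀ).trace := by
  have hB : Measurable (toEuclideanCLM (𝕜 := ℝ) B) := by fun_prop
  have hC : Measurable (toEuclideanCLM (𝕜 := ℝ) C) := by fun_prop
  have hπ : IsFiniteMeasure π := by
    have : IsFiniteMeasure (π.map Prod.fst) := by rw [h1]; infer_instance
    exact Measure.isFiniteMeasure_of_map measurable_fst.aemeasurable
  obtain ⟨π', h1', h2', h⟩ := exists_coupling_lintegral_le (π := π) hB hC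
    (h1.trans (map_centeredGaussian hU.posSemidef B).symm)
    (h2.trans (map_centeredGaussian hV.posSemidef C).symm)
  rw [← lintegral_norm_sq_centeredGaussian hU.posSemidef,
    ← lintegral_norm_sq_centeredGaussian hV.posSemidef, map_sub, map_sub, map_one]
  exact (buresSq_le_lintegral hU hV h1' h2').trans h

lemma lintegral_enorm_sq_centeredGaussian_ne_top (hV : V.PosSemidef)
    (B : Matrix (Fin p) (Fin p) ℝ) :
    ∫⁻ x, ‖x‖ₑ ^ 2 ∂centeredGaussian (B * V * Bᵀ) ≠ ⊤ := by
  rw [← map_centeredGaussian hV, lintegral_map (by fun_prop) (by fun_prop),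
    lintegral_norm_sq_centeredGaussian hV]
  exact ENNReal.ofReal_ne_top

/-- A substitute for the triangle inequality: passing from `N(0, U)` and `N(0, V)` to their linear
images costs at most a factor `2` and the squared displacements of the two maps. -/
lemma buresSq_le_wassersteinSq_map (hU : U.PosDef) (hV : V.PosDef)
    (B C : Matrix (Fin p) (Fin p) ℝ) :
    buresSq U V ≤ 2 * wassersteinSq (centeredGaussian (B * U * Bᵀ)) (centeredGaussian (C * V * Cᵀ))
      + 4 * ((B - 1) * U * (B - 1)ᵀ).trace + 4 * ((C - 1) * V * (C - 1)ᵀ).trace := by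
  set a := ((B - 1) * U * (B - 1)ᵀ).trace with ha
  set b := ((C - 1) * V * (C - 1)ᵀ).trace with hb
  have ha0 : 0 ≤ a := trace_mul_mul_transpose_nonneg hU.posSemidef _
  have hb0 : 0 ≤ b := trace_mul_mul_transpose_nonneg hV.posSemidef _
  suffices h : (buresSq U V - 4 * a - 4 * b) / 2 ≤
      wassersteinSq (centeredGaussian (B * U * Bᵀ)) (centeredGaussian (C * V * Cᵀ)) by linarith
  -- The product coupling shows that the infimum is finite, so `toReal` is not a junk value.
  refine le_wassersteinSq (fun π h1 h2 => ?_)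
    (π := (centeredGaussian (B * U * Bᵀ)).prod (centeredGaussian (C * V * Cᵀ)))
    Measure.fst_prod Measure.snd_prod ?_
  · have key := ofReal_buresSq_le_of_coupling hU hV B C h1 h2
    rw [← ha, ← hb] at key
    rcases eq_or_ne (∫⁻ z, ‖z.1 - z.2‖ₑ ^ 2 ∂π) ⊤ with htop | htop
    · rw [htop]; exact le_top
    · rw [← ENNReal.ofReal_toReal htop] at key ⊢
      set w := (∫⁻ z, ‖z.1 - z.2‖ₑ ^ 2 ∂π).toReal
      have hw : 0 ≤ w := ENNReal.toReal_nonneg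
      rw [show (2 : ENNReal) = ENNReal.ofReal 2 by simp, show (4 : ENNReal) = ENNReal.ofReal 4 by
        simp, ← ENNReal.ofReal_mul (by norm_num), ← ENNReal.ofReal_mul (by norm_num),
        ← ENNReal.ofReal_mul (by norm_num), ← ENNReal.ofReal_add (by positivity) (by positivity),
        ← ENNReal.ofReal_add (by positivity) (by positivity),
        ENNReal.ofReal_le_ofReal_iff (by positivity)] at key
      exact ENNReal.ofReal_le_ofReal (by linarith)
  · exact lintegral_prod_enorm_sub_sq_ne_top
      (lintegral_enorm_sq_centeredGaussian_ne_top hU.posSemidef B)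
      (lintegral_enorm_sq_centeredGaussian_ne_top hV.posSemidef C)

end Bures

/-! ### Concentration -/

section Concentration

variable {Ω : Type*} [MeasurableSpace Ω] {P : Measure Ω}

lemma integral_exp_sq_div_four_gaussianReal :
    ∫ x, Real.exp (x ^ 2 / 4) ∂gaussianReal 0 1 = √2 := by
  rw [integral_gaussianReal_eq_integral_smul one_ne_zero]
  have e : ∀ x : ℝ, gaussianPDFReal 0 1 x • Real.exp (x ^ 2 / 4) =
      (√(2 * Real.pi))⁻¹ * Real.exp (-(1 / 4) * x ^ 2) := by
    intro x
    rw [gaussianPDFReal, smul_eq_mul, mul_assoc, ← Real.exp_add]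
    simp only [NNReal.coe_one, sub_zero, mul_one]
    congr 2
    ring
  simp only [e]
  rw [integral_const_mul, integral_gaussian, ← Real.sqrt_inv, ← Real.sqrt_mul (by positivity)]
  congr 1
  field_simp
  norm_num

lemma integrable_exp_sq_div_four_gaussianReal :
    Integrable (fun x => Real.exp (x ^ 2 / 4)) (gaussianReal 0 1) := by
  refine Integrable.of_integral_ne_zero ?_
  rw [integral_exp_sq_div_four_gaussianReal]
  positivity

variable [IsProbabilityMeasure P]

/-- Simultaneous control of the maximum and of the `ℓ²` norm of pairwise independent nonnegative
variables with an exponential moment. The maximum is handled by Markov's inequality and a union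
bound, the sum of squares by Chebyshev's inequality, whose failure probability is already of the
order `1 / n`. -/
lemma measureReal_max_or_sum_sq_le {n : ℕ} (hn : 1 ≤ n) {u : Fin n → Ω → ℝ}
    (hm : ∀ i, AEMeasurable (u i) P) (h0 : ∀ i ω, 0 ≤ u i ω)
    (hind : Pairwise fun i j => IndepFun (u i) (u j) P)
    (hint : ∀ i, Integrable (fun ω => Real.exp (u i ω / 4)) P)
    (hexp : ∀ i, ∫ ω, Real.exp (u i ω / 4) ∂P ≤ 3 / 2) :
    P.real {ω | ¬ ((∀ i, u i ω ≤ 8 * Real.log n) ∧ ∑ i, u i ω ^ 2 ≤ 49 * n)} ≤ 10000 / n := by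
  have hn0 : (0 : ℝ) < n := by exact_mod_cast hn
  have p2 : ∀ i ω, u i ω ^ 2 ≤ 32 * Real.exp (u i ω / 4) := by
    intro i ω
    have := Real.pow_div_factorial_le_exp (x := u i ω / 4) (by have := h0 i ω; positivity) 2
    norm_num [Nat.factorial] at this
    linarith
  have p4 : ∀ i ω, (u i ω ^ 2) ^ 2 ≤ 6144 * Real.exp (u i ω / 4) := by
    intro i ω
    have := Real.pow_div_factorial_le_exp (x := u i ω / 4) (by have := h0 i ω; positivity) 4
    norm_num [Nat.factorial] at this
    linarith [show (u i ω ^ 2) ^ 2 = u i ω ^ 4 by ring,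
      show (u i ω / 4) ^ 4 = u i ω ^ 4 / 256 by ring]
  have hm2 : ∀ i, AEMeasurable (fun ω => u i ω ^ 2) P := fun i => (hm i).pow_const 2
  have i4 : ∀ i, Integrable (fun ω => (u i ω ^ 2) ^ 2) P := fun i =>
    ((hint i).const_mul 6144).mono' ((hm2 i).pow_const 2).aestronglyMeasurable
      (ae_of_all _ fun ω => by rw [Real.norm_of_nonneg (by positivity)]; exact p4 i ω)
  have i2 : ∀ i, Integrable (fun ω => u i ω ^ 2) P := fun i =>
    ((hint i).const_mul 32).mono' (hm2 i).aestronglyMeasurable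
      (ae_of_all _ fun ω => by rw [Real.norm_of_nonneg (by positivity)]; exact p2 i ω)
  have hL : ∀ i, MemLp (fun ω => u i ω ^ 2) 2 P := fun i =>
    (memLp_two_iff_integrable_sq (hm2 i).aestronglyMeasurable).2 (i4 i)
  have e2 : ∀ i, ∫ ω, u i ω ^ 2 ∂P ≤ 48 := by
    intro i
    have := integral_mono (i2 i) ((hint i).const_mul 32) (p2 i)
    rw [integral_const_mul] at this
    linarith [hexp i]
  have v4 : ∀ i, variance (fun ω => u i ω ^ 2) P ≤ 9216 := by
    intro i
    have := integral_mono (i4 i) ((hint i).const_mul 6144) (p4 i)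
    rw [integral_const_mul] at this
    have h := variance_le_expectation_sq (X := fun ω => u i ω ^ 2) (hm2 i).aestronglyMeasurable
    simp only [Pi.pow_apply] at h
    linarith [hexp i]
  set S : Ω → ℝ := ∑ i, fun ω => u i ω ^ 2 with hS
  have hSL : MemLp S 2 P := memLp_finsetSum' _ fun i _ => hL i
  have hSv : variance S P ≤ 9216 * n := by
    rw [hS, IndepFun.variance_sum (fun i _ => hL i)]
    · refine (Finset.sum_le_sum fun i _ => v4 i).trans_eq ?_
      simp [mul_comm]
    · intro i _ j _ hij
      exact (hind hij).comp (measurable_id.pow_const 2) (measurable_id.pow_const 2)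
  have hSe : ∫ ω, S ω ∂P ≤ 48 * n := by
    simp only [hS, Finset.sum_apply]
    rw [integral_finsetSum _ fun i _ => i2 i]
    refine (Finset.sum_le_sum fun i _ => e2 i).trans_eq ?_
    simp [mul_comm]
  have hcheb : P.real {ω | (n : ℝ) ≤ |S ω - ∫ ω, S ω ∂P|} ≤ 9216 / n := by
    have h := ENNReal.toReal_mono ENNReal.ofReal_ne_top (meas_ge_le_variance_div_sq hSL hn0)
    rw [ENNReal.toReal_ofReal (div_nonneg (variance_nonneg _ _) (by positivity))] at h
    refine h.trans ?_
    rw [div_le_div_iff₀ (by positivity) hn0]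
    nlinarith [mul_le_mul_of_nonneg_right hSv hn0.le]
  have htail : ∀ i, P.real {ω | 8 * Real.log n < u i ω} ≤ (3 / 2) / n ^ 2 := by
    intro i
    have h := mul_meas_ge_le_integral_of_nonneg (ae_of_all P fun ω => (Real.exp_pos _).le)
      (hint i) ((n : ℝ) ^ 2)
    rw [le_div_iff₀ (by positivity), mul_comm]
    refine le_trans ?_ (h.trans (hexp i))
    gcongr
    · exact measure_ne_top _ _
    · rename_i ω
      intro hω
      have hω' : 2 * Real.log n ≤ u i ω / 4 := by linarith
      calc (n : ℝ) ^ 2 = Real.exp (2 * Real.log n) := by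
            rw [mul_comm, Real.exp_mul, Real.exp_log hn0]; norm_cast
        _ ≤ _ := Real.exp_le_exp.2 hω'
  have hsub : {ω | ¬ ((∀ i, u i ω ≤ 8 * Real.log n) ∧ ∑ i, u i ω ^ 2 ≤ 49 * n)} ⊆
      (⋃ i, {ω | 8 * Real.log n < u i ω}) ∪ {ω | (n : ℝ) ≤ |S ω - ∫ ω, S ω ∂P|} := by
    intro ω hω
    simp only [Set.mem_ofPred_eq, not_and_or, not_forall, not_le] at hω
    refine hω.imp (fun h => Set.mem_iUnion.2 h) fun h => ?_
    have hSω : S ω = ∑ i, u i ω ^ 2 := by simp [hS]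
    have := le_abs_self (S ω - ∫ ω, S ω ∂P)
    simp only [Set.mem_ofPred_eq]
    linarith
  calc _ ≤ P.real ((⋃ i, {ω | 8 * Real.log n < u i ω}) ∪
        {ω | (n : ℝ) ≤ |S ω - ∫ ω, S ω ∂P|}) := measureReal_mono hsub
    _ ≤ P.real (⋃ i, {ω | 8 * Real.log n < u i ω}) +
        P.real {ω | (n : ℝ) ≤ |S ω - ∫ ω, S ω ∂P|} := measureReal_union_le _ _
    _ ≤ ∑ i : Fin n, (3 / 2) / (n : ℝ) ^ 2 + 9216 / n :=
        add_le_add ((measureReal_iUnion_fintype_le _).trans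
          (Finset.sum_le_sum fun i _ => htail i)) hcheb
    _ ≤ 10000 / n := by
        rw [Finset.sum_const, Finset.card_univ, Fintype.card_fin, nsmul_eq_mul,
          show (n : ℝ) * (3 / 2 / n ^ 2) = (3 / 2) / n by field_simp, ← add_div]
        gcongr
        norm_num

end Concentration

/-! ### Frobenius norms of the noise matrices -/

section SymN

variable {Ω : Type*} [MeasurableSpace Ω] {P : Measure Ω} {n p : ℕ}
  {X : Fin n → Ω → Matrix (Fin p) (Fin p) ℝ}

lemma IsIIDSymN.hasLaw_entry (hX : IsIIDSymN P X) (i : Fin n) (a b : Fin p) :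
    HasLaw (fun ω => X i ω a b) (gaussianReal 0 1) P := by
  rcases le_total a b with h | h
  · exact hX.law i a b h
  · refine (hX.law i b a h).congr ?_
    filter_upwards [hX.symm i] with ω hω
    exact hω.apply b a

lemma IsIIDSymN.aemeasurable_frobSq (hX : IsIIDSymN P X) (i : Fin n) :
    AEMeasurable (fun ω => frobSq (X i ω)) P := by
  unfold frobSq
  refine Finset.aemeasurable_fun_sum _ fun a _ => Finset.aemeasurable_fun_sum _ fun b _ => ?_
  exact (hX.hasLaw_entry i a b).aemeasurable.pow_const 2

/-- The Frobenius norms are independent across the matrices: almost surely they are functions of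
the entries on and above the diagonal. -/
lemma IsIIDSymN.indepFun_frobSq (hX : IsIIDSymN P X) {i j : Fin n} (hij : i ≠ j) :
    IndepFun (fun ω => frobSq (X i ω)) (fun ω => frobSq (X j ω)) P := by
  classical
  let ι := Fin n × {ab : Fin p × Fin p // ab.1 ≤ ab.2}
  let s : Fin n → Finset ι := fun k => Finset.univ.filter fun q => q.1 = k
  have hd : Disjoint (s i) (s j) := by
    rw [Finset.disjoint_left]
    intro q hi hj
    exact hij ((Finset.mem_filter.1 hi).2.symm.trans (Finset.mem_filter.1 hj).2)
  have h := hX.indep.indepFun_finset₀ (s i) (s j) hd fun q =>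
    (hX.law q.1 q.2.1.1 q.2.1.2 q.2.2).aemeasurable
  let φ : ∀ k, (s k → ℝ) → ℝ := fun k v => ∑ a, ∑ b,
    v ⟨(k, ⟨(min a b, max a b), min_le_max⟩), by simp [s]⟩ ^ 2
  have hφ : ∀ k, Measurable (φ k) := fun k => by fun_prop
  have key : ∀ k, (φ k ∘ fun ω (q : s k) => X q.1.1 ω q.1.2.1.1 q.1.2.1.2) =ᵐ[P]
      fun ω => frobSq (X k ω) := by
    intro k
    filter_upwards [hX.symm k] with ω hω
    simp only [φ, Function.comp_apply, frobSq]
    refine Finset.sum_congr rfl fun a _ => Finset.sum_congr rfl fun b _ => ?_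
    rcases le_total a b with hab | hab
    · simp [hab]
    · simp [hab, hω.apply a b]
  exact (h.comp (hφ i) (hφ j)).congr (key i) (key j)

/-- Jensen's inequality bounds the exponential of the mean square entry by the mean of the
exponentials. -/
lemma exp_frobSq_div_le (hp : 0 < p) (B : Matrix (Fin p) (Fin p) ℝ) :
    Real.exp (frobSq B / (p : ℝ) ^ 2 / 4) ≤
      ∑ a, ∑ b, ((p : ℝ) ^ 2)⁻¹ * Real.exp (B a b ^ 2 / 4) := by
  have hp0 : (p : ℝ) ≠ 0 := by exact_mod_cast hp.ne'
  have h := convexOn_exp.map_sum_le (t := (Finset.univ : Finset (Fin p × Fin p)))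
    (w := fun _ => ((p : ℝ) ^ 2)⁻¹) (p := fun q => B q.1 q.2 ^ 2 / 4)
    (fun _ _ => by positivity) (by simp; field_simp) (fun _ _ => Set.mem_univ _)
  simp only [smul_eq_mul, Fintype.sum_prod_type] at h
  refine le_trans (le_of_eq ?_) h
  congr 1
  simp only [frobSq, Finset.sum_div]
  refine Finset.sum_congr rfl fun a _ => Finset.sum_congr rfl fun b _ => ?_
  field_simp

lemma IsIIDSymN.integrable_exp_frobSq [IsProbabilityMeasure P] (hX : IsIIDSymN P X) (hp : 0 < p)
    (i : Fin n) :
    Integrable (fun ω => Real.exp (frobSq (X i ω) / (p : ℝ) ^ 2 / 4)) P ∧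
      ∫ ω, Real.exp (frobSq (X i ω) / (p : ℝ) ^ 2 / 4) ∂P ≤ 3 / 2 := by
  have hp0 : (p : ℝ) ≠ 0 := by exact_mod_cast hp.ne'
  have hi : ∀ a b, Integrable (fun ω => Real.exp (X i ω a b ^ 2 / 4)) P := by
    intro a b
    have h := hX.hasLaw_entry i a b
    have := integrable_exp_sq_div_four_gaussianReal
    rw [← h.map_eq] at this
    exact this.comp_aemeasurable h.aemeasurable
  have he : ∀ a b, ∫ ω, Real.exp (X i ω a b ^ 2 / 4) ∂P = √2 := by
    intro a b
    rw [← integral_exp_sq_div_four_gaussianReal]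
    exact (hX.hasLaw_entry i a b).integral_comp (f := fun x => Real.exp (x ^ 2 / 4)) (by fun_prop)
  have hsum : Integrable
      (fun ω => ∑ a, ∑ b, ((p : ℝ) ^ 2)⁻¹ * Real.exp (X i ω a b ^ 2 / 4)) P :=
    integrable_finsetSum _ fun a _ => integrable_finsetSum _ fun b _ => (hi a b).const_mul _
  have hI : Integrable (fun ω => Real.exp (frobSq (X i ω) / (p : ℝ) ^ 2 / 4)) P := by
    refine hsum.mono' ?_ (ae_of_all _ fun ω => ?_)
    · exact (Real.measurable_exp.comp_aemeasurable
        (((hX.aemeasurable_frobSq i).div_const _).div_const _)).aestronglyMeasurable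
    · rw [Real.norm_of_nonneg (Real.exp_pos _).le]
      exact exp_frobSq_div_le hp _
  refine ⟨hI, (integral_mono hI hsum fun ω => exp_frobSq_div_le hp _).trans ?_⟩
  rw [integral_finsetSum _ fun a _ => integrable_finsetSum _ fun b _ => (hi a b).const_mul _]
  simp only [integral_finsetSum _ fun b _ => (hi _ b).const_mul _, integral_const_mul, he]
  have h2 : √2 ≤ 3 / 2 := by
    rw [Real.sqrt_le_left (by norm_num)]
    norm_num
  simp only [Finset.sum_const, Finset.card_univ, Fintype.card_fin, nsmul_eq_mul]
  rw [show (p : ℝ) * (p * (((p : ℝ) ^ 2)⁻¹ * √2)) = √2 by field_simp]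
  exact h2

/-- The good event for the noise matrices. -/
lemma IsIIDSymN.measureReal_frobSq_le [IsProbabilityMeasure P] (hX : IsIIDSymN P X) (hn : 1 ≤ n)
    (hp : 0 < p) :
    P.real {ω | ¬ ((∀ i, frobSq (X i ω) ≤ 8 * p ^ 2 * Real.log n) ∧
      ∑ i, frobSq (X i ω) ^ 2 ≤ (7 * p ^ 2 * √n) ^ 2)} ≤ 10000 / n := by
  have hp0 : (0 : ℝ) < p := by exact_mod_cast hp
  have h := measureReal_max_or_sum_sq_le (P := P) hn
    (u := fun i ω => frobSq (X i ω) / (p : ℝ) ^ 2)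
    (fun i => (hX.aemeasurable_frobSq i).div_const _)
    (fun i ω => div_nonneg (frobSq_nonneg _) (by positivity))
    (fun i j hij => (hX.indepFun_frobSq hij).comp (measurable_id.div_const _)
      (measurable_id.div_const _))
    (fun i => (hX.integrable_exp_frobSq hp i).1) (fun i => (hX.integrable_exp_frobSq hp i).2)
  refine le_of_eq_of_le ?_ h
  congr! 5 with ω
  · refine forall_congr' fun i => ?_
    rw [div_le_iff₀ (by positivity)]
    ring_nf
  · simp only [div_pow]
    rw [← Finset.sum_div, div_le_iff₀ (by positivity), mul_pow, Real.sq_sqrt (by positivity)]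
    ring_nf

end SymN

/-! ### Distances in the model and exact recovery -/

section Model

variable {n p K : ℕ} {g : Fin n → Fin K} {V : Fin K → Matrix (Fin p) (Fin p) ℝ} {t : ℝ}
  {X : Fin n → Matrix (Fin p) (Fin p) ℝ}

lemma norm_le_maxOpNorm (V : Fin K → Matrix (Fin p) (Fin p) ℝ) (k : Fin K) :
    ‖toEuclideanCLM (𝕜 := ℝ) (V k)‖ ≤ maxOpNorm V :=
  le_ciSup (f := fun k => ‖toEuclideanCLM (𝕜 := ℝ) (V k)‖) (Set.finite_range _).bddAbove k

lemma maxOpNorm_nonneg (V : Fin K → Matrix (Fin p) (Fin p) ℝ) : 0 ≤ maxOpNorm V :=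
  Real.iSup_nonneg fun _ => norm_nonneg _

lemma separationSq_le (V : Fin K → Matrix (Fin p) (Fin p) ℝ) {k l : Fin K} (hkl : k ≠ l) :
    separationSq V ≤ buresSq (V k) (V l) :=
  ciInf_le (f := fun q : {q : Fin K × Fin K // q.1 ≠ q.2} => buresSq (V q.1.1) (V q.1.2))
    (Set.finite_range _).bddBelow ⟨(k, l), hkl⟩

lemma trace_smul_mul_le (V : Fin K → Matrix (Fin p) (Fin p) ℝ) (k : Fin K) (t : ℝ)
    (B : Matrix (Fin p) (Fin p) ℝ) :
    ((t • B) * V k * (t • B)ᵀ).trace ≤ t ^ 2 * maxOpNorm V * frobSq B := by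
  refine (trace_mul_mul_transpose_le _ _).trans ?_
  rw [frobSq_smul]
  have h1 := mul_le_mul_of_nonneg_right (norm_le_maxOpNorm V k)
    (mul_nonneg (sq_nonneg t) (frobSq_nonneg B))
  linarith

lemma perturbedCov_eq (hX : ∀ i, (X i).IsSymm) (i : Fin n) :
    perturbedCov g V t X i = (1 + t • X i) * V (g i) * (1 + t • X i)ᵀ := by
  rw [perturbedCov, transpose_add, transpose_one, transpose_smul, (hX i).eq]

lemma distanceMatrix_le (hV : ∀ k, (V k).PosDef) (hX : ∀ i, (X i).IsSymm) {i j : Fin n}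
    (hij : g i = g j) :
    distanceMatrix (perturbedCov g V t X) i j ≤
      2 * t ^ 2 * maxOpNorm V * (frobSq (X i) + frobSq (X j)) := by
  rw [distanceMatrix, of_apply, perturbedCov_eq hX, perturbedCov_eq hX, ← hij]
  refine (wassersteinSq_map_le (hV _).posSemidef _ _).trans ?_
  rw [add_sub_add_left_eq_sub, ← smul_sub]
  refine (trace_smul_mul_le V _ t _).trans ?_
  have := mul_le_mul_of_nonneg_left (frobSq_sub_le (X i) (X j))
    (mul_nonneg (sq_nonneg t) (maxOpNorm_nonneg V))
  linarith

lemma separationSq_le_distanceMatrix (hV : ∀ k, (V k).PosDef) (hX : ∀ i, (X i).IsSymm)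
    {i j : Fin n} (hij : g i ≠ g j) :
    separationSq V ≤ 2 * distanceMatrix (perturbedCov g V t X) i j
      + 4 * t ^ 2 * maxOpNorm V * (frobSq (X i) + frobSq (X j)) := by
  rw [distanceMatrix, of_apply, perturbedCov_eq hX, perturbedCov_eq hX]
  have h := buresSq_le_wassersteinSq_map (hV (g i)) (hV (g j)) (1 + t • X i) (1 + t • X j)
  rw [add_sub_cancel_left, add_sub_cancel_left] at h
  have h1 := trace_smul_mul_le V (g i) t (X i)
  have h2 := trace_smul_mul_le V (g j) t (X j)
  have h3 := separationSq_le V hij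
  linarith

/-- Exact recovery on the good event for the noise matrices. -/
theorem isUniqueSDPSolution_of_frobSq_le (hK : 2 ≤ K) (hg : Function.Surjective g)
    (hV : ∀ k, (V k).PosDef) (hX : ∀ i, (X i).IsSymm) {C₅ : ℝ}
    (hsep : (192 + 112 * C₅) * (t ^ 2 * maxOpNorm V * p ^ 2 * Real.log n) < separationSq V)
    (hm : (n : ℝ) / minHarmonicMean g ≤ C₅ * Real.log n)
    (hmax : ∀ i, frobSq (X i) ≤ 8 * p ^ 2 * Real.log n)
    (hsum : ∑ i, frobSq (X i) ^ 2 ≤ (7 * p ^ 2 * √n) ^ 2) :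
    IsUniqueSDPSolution K (distanceMatrix (perturbedCov g V t X)) (membershipMatrix g) := by
  have hM := maxOpNorm_nonneg V
  have hH := minHarmonicMean_pos hK hg
  set Q := t ^ 2 * maxOpNorm V * p ^ 2 * Real.log n with hQ
  have hc : 0 ≤ 2 * t ^ 2 * maxOpNorm V := by positivity
  refine isUniqueSDPSolution_of_gap hg (c := 2 * t ^ 2 * maxOpNorm V)
    (D := separationSq V / 2 - 32 * Q) (ξ := 8 * p ^ 2 * Real.log n) (s := 7 * p ^ 2 * √n)
    (L := minHarmonicMean g / 2) (x := fun i => frobSq (X i)) hc (by positivity) (by positivity)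
    (fun i => frobSq_nonneg _) hmax hsum (fun k => ?_) (fun i j _ => wassersteinSq_nonneg)
    (fun i j hij => distanceMatrix_le hV hX hij) (fun i j hij => ?_) ?_
  · have := minHarmonicMean_le hK hg k
    linarith
  · have h := separationSq_le_distanceMatrix (t := t) hV hX hij
    have h2 := mul_le_mul_of_nonneg_left (add_le_add (hmax i) (hmax j)) hc
    rw [hQ]
    linarith
  · have e : 2 * (2 * t ^ 2 * maxOpNorm V) * (7 * p ^ 2 * √n) * √n / (minHarmonicMean g / 2) =
        56 * (t ^ 2 * maxOpNorm V * p ^ 2) * (n / minHarmonicMean g) := by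
      have := Real.mul_self_sqrt (Nat.cast_nonneg (α := ℝ) n)
      calc _ = 56 * (t ^ 2 * maxOpNorm V * p ^ 2) * ((√n * √n) / minHarmonicMean g) := by
            field_simp; ring
        _ = _ := by rw [this]
    have h2 := mul_le_mul_of_nonneg_left hm
      (show 0 ≤ 56 * (t ^ 2 * maxOpNorm V * p ^ 2) by positivity)
    rw [e]
    rw [hQ] at hsep ⊢
    linarith

end Model

end WassersteinSDP

theorem theorem1 (C₃ C₄ C₅ : ℝ) (hC₃ : 0 < C₃) (hC₄ : 0 < C₄) (hC₅ : 0 < C₅) :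
    ∃ C₁ C₂ : ℝ, 0 < C₁ ∧ 0 < C₂ ∧
      ∀ (n p K : ℕ) (_ : 2 ≤ K)
        (g : Fin n → Fin K) (_ : Function.Surjective g)
        (V : Fin K → Matrix (Fin p) (Fin p) ℝ) (_ : ∀ k, (V k).PosDef)
        (t : ℝ) (_ : 0 ≤ t) (β : ℝ) (_ : 0 < β) (_ : β < 1)
        (Ω : Type*) (_ : MeasurableSpace Ω) (P : MeasureTheory.Measure Ω)
        (_ : MeasureTheory.IsProbabilityMeasure P)
        (X : Fin n → Ω → Matrix (Fin p) (Fin p) ℝ) (_ : WassersteinSDP.IsIIDSymN P X),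
        C₁ * t ^ 2 / min ((1 - β) ^ 2) (β ^ 2) * WassersteinSDP.maxOpNorm V * (p : ℝ) ^ 2 *
            Real.log n < WassersteinSDP.separationSq V →
        C₃ * Real.log n ^ 2 ≤ (WassersteinSDP.minClusterSize g : ℝ) →
        t ≤ C₄ * √(Real.log n) /
          (((p : ℝ) + Real.log (WassersteinSDP.maxClusterSize g)) *
            √(WassersteinSDP.maxOpNorm V) * √(WassersteinSDP.maxTraceInv V)) →
        (n : ℝ) / WassersteinSDP.minHarmonicMean g ≤ C₅ * Real.log n →
        1 - C₂ / n ≤ P.real {ω |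
          WassersteinSDP.IsUniqueSDPSolution K
            (WassersteinSDP.distanceMatrix
              (WassersteinSDP.perturbedCov g V t (fun i => X i ω)))
            (WassersteinSDP.membershipMatrix g)} := by
  open WassersteinSDP in
  -- The separation term `192` collects the largest noise norm, `112 C₅` the `ℓ²` norm of the noise.
  refine ⟨192 + 112 * C₅, 10000, by positivity, by norm_num, ?_⟩
  intro n p K hK g hg V hV t _ β hβ0 hβ1 Ω _ P _ X hX hsep _ _ hm
  obtain ⟨i₀, -⟩ := hg ⟨0, by omega⟩
  have hn : 1 ≤ n := i₀.pos
  have hM := maxOpNorm_nonneg V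
  have hlog : 0 ≤ Real.log n := Real.log_natCast_nonneg n
  have hmin : 0 < min ((1 - β) ^ 2) (β ^ 2) :=
    lt_min (pow_pos (sub_pos.2 hβ1) 2) (pow_pos hβ0 2)
  have hmin1 : min ((1 - β) ^ 2) (β ^ 2) ≤ 1 := (min_le_right _ _).trans (by nlinarith)
  -- For `p = 0` the Bures distance vanishes, so strict separation forces `0 < p`.
  have hp : 0 < p := by
    rcases Nat.eq_zero_or_pos p with rfl | hp
    · have : Nontrivial (Fin K) := Fin.nontrivial_iff_two_le.2 hK
      obtain ⟨k, l, hkl⟩ := exists_pair_ne (Fin K)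
      have := separationSq_le V hkl
      simp [buresSq, trace] at this hsep
      linarith
    · exact hp
  have hsep' : (192 + 112 * C₅) * (t ^ 2 * maxOpNorm V * p ^ 2 * Real.log n) <
      separationSq V := by
    refine lt_of_le_of_lt ?_ hsep
    have h1 : (192 + 112 * C₅) * t ^ 2 ≤
        (192 + 112 * C₅) * t ^ 2 / min ((1 - β) ^ 2) (β ^ 2) :=
      le_div_self (by positivity) hmin hmin1
    have h2 := mul_le_mul_of_nonneg_right h1
      (show 0 ≤ maxOpNorm V * p ^ 2 * Real.log n by positivity)
    linarith
  have hbad := hX.measureReal_frobSq_le hn hp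
  set G := {ω | IsUniqueSDPSolution K (distanceMatrix (perturbedCov g V t (fun i => X i ω)))
    (membershipMatrix g)} with hG
  have hsymm : ∀ᵐ ω ∂P, ∀ i, (X i ω).IsSymm := ae_all_iff.2 hX.symm
  have hGc : P.real Gᶜ ≤ 10000 / n := by
    refine le_trans ?_ hbad
    refine ENNReal.toReal_mono (measure_ne_top _ _) (measure_mono_ae ?_)
    filter_upwards [hsymm] with ω hω hωG hgood
    exact hωG (isUniqueSDPSolution_of_frobSq_le hK hg hV hω hsep' hm hgood.1 hgood.2)
  have h1 : (1 : ℝ) ≤ P.real G + P.real Gᶜ := by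
    have := measureReal_union_le (μ := P) G Gᶜ
    rwa [Set.union_compl_self, probReal_univ] at this
  linarith
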